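/- Let $G=(V,E)$ be a finite undirected graph without loops, with $|V|=n$, edge weights $w_{ij}=w_{ji}>0$ for $\{i,j\}\in E$ and $w_{ij}=0$ for $\{i,j\}\notin E$, and vertex weights $\mu_i\ge 0$ such that $\mathrm{vol}(V)=\sum_{i\in V}\mu_i>0$ (the unweighted case is $w_{ij}=1$ on edges, $\mu_i=\deg(i)$). For disjoint $A,B\subseteq V$ let $|E(A,B)|=\sum_{i\in A,\,j\in B}w_{ij}$, and for $x\in\mathbb R^V$ let $I(x)=\sum_{\{i,j\}\in E}w_{ij}|x_i-x_j|$. For $1\le k\le n$ let $$c_k=\inf_{A}\ \max_{x\in A}\frac{I(x)}{\mathrm{vol}(V)\,\|x\|_\infty},$$ where $A$ runs over the compact symmetric ($A=-A$) subsets of $\{x\in\mathbb R^V:\|x\|_\infty=1\}$ with Krasnoselskii genus $\gamma(A)\ge k$; here $\gamma(A)$ is the least $m$ such that there is an odd continuous map $A\to\mathbb R^m\setminus\{0\}$. A vector $x\neq 0$ is an eigenvector for $\lambda\in\mathbb R$ if $0\in\Delta_1x-\lambda\,\mathrm{vol}(V)\,\partial\|x\|_\infty$, where $\partial\|x\|_\infty$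 is the subdifferential of $\|\cdot\|_\infty$ at $x$ and $\Delta_1x$ is the set of all vectors $\big(\sum_{j:\{i,j\}\in E}w_{ij}z_{ij}\big)_{i\in V}$ with $z_{ij}=-z_{ji}\in\mathrm{Sgn}(x_i-x_j)$ for all $\{i,j\}\in E$; here $\mathrm{Sgn}(t)=\{1\}$ if $t>0$, $[-1,1]$ if $t=0$, and $\{-1\}$ if $t<0$. The nodal domains of $x$ are the vertex sets of the connected components of the subgraph induced by $\{i:x_i=\|x\|_\infty\}$ and of those of the subgraph induced by $\{i:-x_i=\|x\|_\infty\}$; the null domains of $x$ are the vertex sets of the connected components of the subgraph induced by $\{i:|x_i|<\|x\|_\infty\}$. For pairwise disjoint $V_1,\dots,V_k\subseteq V$, with $V_0=V\setminus(V_1\cup\dots\cup V_k)$, let $$\mathrm{MC}(V_1,\dots,V_k)=2\max_{S\subseteq\{1,\dots,k\}}\ \sum_{i\in S,\,j\notin S}|E(V_i,V_j)|+\sum_{i=1}^k|E(V_i,V_0)|,$$ and let $M_k$ be the minimum of $\mathrm{MC}(V_1,\dots,V_k)$ over all families of $k$ nonempty pairwise disjoint subsets of $V$ ($1\le k\le n$).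 Theorem. Let $1\le k\le n$. Then $\mathrm{vol}(V)\,c_k\le M_k$. If moreover some eigenvector for $\lambda=c_k$ has exactly $m\geq 1$ nodal domains, or exactly $m\ge 1$ null domains, then $$M_m\le \mathrm{vol}(V)\,c_k\le M_k .$$ In particular, $\mathrm{vol}(V)\,c_n=M_n$, and if $n\ge 2$, then $$\mathrm{vol}(V)\,c_n=M_n=\max_{\emptyset\ne S\subsetneq V}2|E(S,V\setminus S)|,\qquad \mathrm{vol}(V)\,c_2=M_2=\min_{\emptyset\ne S\subsetneq V}2|E(S,V\setminus S)|.$$ -/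

import Mathlib

noncomputable section

/-- A finite undirected weighted graph without loops on the vertex set `V`: symmetric edge weights
`w`, positive exactly on the edges, and nonnegative vertex weights `μ`. A simple graph is the case
where `w` is the 0-1 adjacency function and `μ i` is the degree of `i`. -/
structure WeightedGraph (V : Type*) where
  toSimpleGraph : SimpleGraph V
  w : V → V → ℝ
  w_symm : ∀ i j, w i j = w j i
  w_pos : ∀ i j, toSimpleGraph.Adj i j → 0 < w i j
  w_zero : ∀ i j, ¬ toSimpleGraph.Adj i j → w i j = 0
  μ : V → ℝ
  μ_nonneg : ∀ i, 0 ≤ μ i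

/-- The set-valued sign: `{1}` for `t > 0`, `[-1, 1]` for `t = 0`, `{-1}` for `t < 0`. -/
def setSgn (t : ℝ) : Set ℝ :=
  if 0 < t then {1} else if t < 0 then {-1} else Set.Icc (-1) 1

/-- The Krasnoselskii genus of a (symmetric) set `A` in `V → ℝ`: the least `m` for which there is
an odd continuous map from `A` to `ℝ^m ∖ {0}` (`⊤` if there is none, and `0` for the empty set). -/
def krasnoselskiiGenus {V : Type*} (A : Set (V → ℝ)) : ℕ∞ :=
  ⨅ (m : ℕ) (_ : ∃ f : (V → ℝ) → (Fin m → ℝ),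
    ContinuousOn f A ∧ (∀ x ∈ A, f (-x) = -f x) ∧ ∀ x ∈ A, f x ≠ 0), (m : ℕ∞)

/-- The subdifferential at `x` of a convex function `f` on `ℝ^V`. -/
def subdifferential {V : Type*} [Fintype V] (f : (V → ℝ) → ℝ) (x : V → ℝ) : Set (V → ℝ) :=
  {s | ∀ y : V → ℝ, f y - f x ≥ ∑ i, s i * (y i - x i)}

/-- `D₊(x) = {i | x_i = ‖x‖_∞}`; the norm of `V → ℝ` is the maximum norm. -/
def domPos {V : Type*} [Fintype V] (x : V → ℝ) : Set V := {i | x i = ‖x‖}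

/-- `D₋(x) = {i | -x_i = ‖x‖_∞}`. -/
def domNeg {V : Type*} [Fintype V] (x : V → ℝ) : Set V := {i | -x i = ‖x‖}

/-- `D₀(x) = {i | |x_i| < ‖x‖_∞}`. -/
def domZero {V : Type*} [Fintype V] (x : V → ℝ) : Set V := {i | |x i| < ‖x‖}

namespace WeightedGraph

variable {V : Type*} [Fintype V]

/-- The volume of the whole vertex set. -/
def vol (G : WeightedGraph V) : ℝ := ∑ i, G.μ i

/-- `|E(A, B)|`, the total weight of the edges between two disjoint vertex sets. -/
def cutWeight (G : WeightedGraph V) (A B : Finset V) : ℝ := ∑ i ∈ A, ∑ j ∈ B, G.w i j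

/-- The total variation `I(x) = ∑_{{i,j} ∈ E} w_ij |x_i - x_j|`; every edge occurs twice in the
double sum. -/
def totalVariation (G : WeightedGraph V) (x : V → ℝ) : ℝ :=
  (∑ i, ∑ j, G.w i j * |x i - x j|) / 2

/-- The graph 1-Laplacian `Δ₁ x`, a set of vectors. -/
def oneLaplacian (G : WeightedGraph V) (x : V → ℝ) : Set (V → ℝ) :=
  {u | ∃ z : V → V → ℝ,
    (∀ i j, G.toSimpleGraph.Adj i j → z i j ∈ setSgn (x i - x j) ∧ z i j = -z j i) ∧
    ∀ i, u i = ∑ j, G.w i j * z i j}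

/-- `(c, x)` is an eigenpair of `0 ∈ Δ₁ x - c vol(V) ∂‖x‖_∞`, with `x ≠ 0`. -/
def IsEigenpair (G : WeightedGraph V) (c : ℝ) (x : V → ℝ) : Prop :=
  x ≠ 0 ∧ ∃ u ∈ G.oneLaplacian x, ∃ s ∈ subdifferential (fun y : V → ℝ => ‖y‖) x,
    0 = u - (c * G.vol) • s

/-- The min-max eigenvalue `c_k`: the infimum of `max_{x ∈ A} I(x) / (vol(V) ‖x‖_∞)` over the
compact symmetric subsets `A` of the unit sphere of `‖·‖_∞` of genus at least `k`. -/
def minmaxEigenvalue (G : WeightedGraph V) (k : ℕ) : ℝ :=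
  sInf {r : ℝ | ∃ A : Set (V → ℝ), A ⊆ Metric.sphere 0 1 ∧ IsCompact A ∧ (∀ x ∈ A, -x ∈ A) ∧
    (k : ℕ∞) ≤ krasnoselskiiGenus A ∧
    IsGreatest ((fun x => G.totalVariation x / (G.vol * ‖x‖)) '' A) r}

/-- The number of nodal domains of `x`: the connected components of the subgraphs induced by
`D₊(x)` and by `D₋(x)`. -/
def numNodalDomains (G : WeightedGraph V) (x : V → ℝ) : ℕ :=
  Nat.card (G.toSimpleGraph.induce (domPos x)).ConnectedComponent +
    Nat.card (G.toSimpleGraph.induce (domNeg x)).ConnectedComponent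

/-- The number of null domains of `x`: the connected components of the subgraph induced by
`D₀(x)`. -/
def numNullDomains (G : WeightedGraph V) (x : V → ℝ) : ℕ :=
  Nat.card (G.toSimpleGraph.induce (domZero x)).ConnectedComponent

open Classical in
/-- `MC(P_1, …, P_k)` for pairwise disjoint vertex sets; the vertices in none of the `P_i` form
the set `P_0`. -/
def multiCut (G : WeightedGraph V) {k : ℕ} (P : Fin k → Finset V) : ℝ :=
  2 * (⨆ S : Finset (Fin k), ∑ i ∈ S, ∑ j ∈ Sᶜ, G.cutWeight (P i) (P j)) +
    ∑ i, G.cutWeight (P i) (Finset.univ.filter fun v => ∀ j, v ∉ P j)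

/-- `M_k`: the minimum of `MC` over all families of `k` nonempty pairwise disjoint vertex sets. -/
def minmaxCut (G : WeightedGraph V) (k : ℕ) : ℝ :=
  ⨅ P : {P : Fin k → Finset V //
    (∀ i, (P i).Nonempty) ∧ ∀ i j, i ≠ j → Disjoint (P i) (P j)}, G.multiCut P.1

open Classical in
/-- The value of the maximum cut, each cut edge being counted twice:
`max 2|E(S, Sᶜ)|` over the nonempty proper subsets `S`. -/
def maxcut (G : WeightedGraph V) : ℝ :=
  ⨆ S : {S : Finset V // S ≠ ∅ ∧ S ≠ Finset.univ}, 2 * G.cutWeight S.1 S.1ᶜ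

open Classical in
/-- The value of the minimum cut, each cut edge being counted twice:
`min 2|E(S, Sᶜ)|` over the nonempty proper subsets `S`. -/
def mincut (G : WeightedGraph V) : ℝ :=
  ⨅ S : {S : Finset V // S ≠ ∅ ∧ S ≠ Finset.univ}, 2 * G.cutWeight S.1 S.1ᶜ

end WeightedGraph

end

/-! Upper bound. On the functions that are constant on each of `k` disjoint blocks and vanish
elsewhere, `I` is a convex function of the block values, so over the cube it is largest at a sign
vector, and there its value is one of the terms whose maximum is `MC`. The step functions of norm 1
form an odd copy of the unit sphere of `ℝ^k`, which has genus at least `k` by `borsuk_ulam`. Hence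
`vol(V) c_k ≤ M_k`.

Eigenvectors. The eigenvalue equation `u = c vol(V) s` is paired with `y = extremalSign x`. A
subgradient `s` of the maximum norm at `x` has ℓ¹-norm 1, lives where `|x_i| = ‖x‖` and has the
signs of `x` there, so it pairs to 1 with `y`. Since `y` is a nondecreasing function of the entries
of `x`, its pairing with `u ∈ Δ₁ x` is `I(y)`. Thus `vol(V) c = I(y)`. Distinct components of one
induced subgraph are not adjacent, and `y` jumps by 2 between opposite signs and by 1 at the
boundary of `D₀`; therefore `I(y)` dominates `MC` of the nodal domains, and also of the null
domains.

Extreme cases. A symmetric subset of the sphere of genus at least `n` omits no point, hence contains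
all ±1 vectors, which yields the maximum cut. A set of genus at least 2 contains a function
attaining both 1 and -1; by the coarea formula its total variation is at least the minimum cut.

The Borsuk–Ulam theorem itself is obtained from Tucker's lemma, a parity count of alternating
simplices modulo 2, applied to iterated barycentric subdivisions of the cross-polytope. -/

noncomputable section

/-! ### Ordered chains modulo two -/

/-- Ordered simplicial chains with coefficients in `ZMod 2`, spanned by the lists of points. -/
abbrev ListChain (E : Type*) := List E →₀ ZMod 2

namespace ListChain

variable {E E' : Type*}

/-- The cone over a chain with apex `x`. -/
def cone (x : E) : ListChain E →ₗ[ZMod 2] ListChain E :=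
  Finsupp.lmapDomain _ _ (List.cons x)

/-- The sum of all the lists obtained from a list by deleting one entry. -/
def listBoundary : List E → ListChain E
  | [] => 0
  | x :: l => Finsupp.single l 1 + cone x (listBoundary l)

/-- The (augmented) simplicial boundary operator. -/
def boundary : ListChain E →ₗ[ZMod 2] ListChain E :=
  Finsupp.linearCombination (ZMod 2) listBoundary

/-- The chain map induced by a map of points. -/
def map (f : E → E') : ListChain E →ₗ[ZMod 2] ListChain E' :=
  Finsupp.lmapDomain _ _ (List.map f)

/-- The evaluation of a cochain, given by its values on lists. -/
def eval (F : List E → ZMod 2) : ListChain E →ₗ[ZMod 2] ZMod 2 :=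
  Finsupp.linearCombination (ZMod 2) F

@[simp] lemma cone_single (x : E) (l : List E) (a : ZMod 2) :
    cone x (Finsupp.single l a) = Finsupp.single (x :: l) a := by
  simp [cone]

@[simp] lemma map_single (f : E → E') (l : List E) (a : ZMod 2) :
    map f (Finsupp.single l a) = Finsupp.single (l.map f) a := by
  simp [map]

@[simp] lemma boundary_single (l : List E) :
    boundary (Finsupp.single l 1) = listBoundary l := by
  simp [boundary]

@[simp] lemma eval_single (F : List E → ZMod 2) (l : List E) :
    eval F (Finsupp.single l 1) = F l := by
  simp [eval]

lemma linearMap_ext {M : Type*} [AddCommMonoid M] [Module (ZMod 2) M]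
    {S T : ListChain E →ₗ[ZMod 2] M}
    (h : ∀ l, S (Finsupp.single l 1) = T (Finsupp.single l 1)) : S = T :=
  Finsupp.lhom_ext' fun l => LinearMap.ext_ring (h l)

/-- Deleting the apex returns `c`; deleting any other entry leaves a cone. Coefficients modulo 2
remove orientation signs, and the empty list counts as a simplex, so points need no exception. -/
lemma boundary_cone (x : E) (c : ListChain E) :
    boundary (cone x c) = c + cone x (boundary c) := by
  have : boundary ∘ₗ cone x = LinearMap.id + cone x ∘ₗ boundary :=
    linearMap_ext fun l => by simp [listBoundary]
  exact LinearMap.congr_fun this c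

lemma boundary_listBoundary (l : List E) : boundary (listBoundary l) = 0 := by
  induction l with
  | nil => simp [listBoundary]
  | cons x l ih =>
    simp [listBoundary, boundary_cone, ih, ZModModule.add_self]

lemma map_cone (f : E → E') (x : E) (c : ListChain E) :
    map f (cone x c) = cone (f x) (map f c) := by
  have : map f ∘ₗ cone x = cone (f x) ∘ₗ map f := linearMap_ext fun l => by simp
  exact LinearMap.congr_fun this c

lemma map_listBoundary (f : E → E') (l : List E) :
    map f (listBoundary l) = listBoundary (l.map f) := by
  induction l with
  | nil => simp [listBoundary]
  | cons x l ih => simp [listBoundary, map_cone, ih]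

lemma boundary_map (f : E → E') (c : ListChain E) :
    boundary (map f c) = map f (boundary c) := by
  have : boundary ∘ₗ map f = map f ∘ₗ boundary :=
    linearMap_ext fun l => by simp [map_listBoundary]
  exact LinearMap.congr_fun this c

lemma map_mem_supported {T : ListChain E →ₗ[ZMod 2] ListChain E'} {S : Set (List E)}
    {S' : Set (List E')}
    (h : ∀ l ∈ S, T (Finsupp.single l 1) ∈ Finsupp.supported (ZMod 2) (ZMod 2) S')
    {c : ListChain E} (hc : c ∈ Finsupp.supported (ZMod 2) (ZMod 2) S) :
    T c ∈ Finsupp.supported (ZMod 2) (ZMod 2) S' := by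
  rw [Finsupp.supported_eq_span_single] at hc
  have : Submodule.span (ZMod 2) ((fun l => Finsupp.single l (1 : ZMod 2)) '' S) ≤
      (Finsupp.supported (ZMod 2) (ZMod 2) S').comap T := by
    rw [Submodule.span_le]
    rintro _ ⟨l, hl, rfl⟩
    exact h l hl
  exact this hc

lemma single_mem_supported {S : Set (List E)} {l : List E} (h : l ∈ S) :
    Finsupp.single l (1 : ZMod 2) ∈ Finsupp.supported (ZMod 2) (ZMod 2) S :=
  Finsupp.single_mem_supported _ _ h

lemma cone_mem_supported {x : E} {S S' : Set (List E)} (h : ∀ l ∈ S, x :: l ∈ S')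
    {c : ListChain E} (hc : c ∈ Finsupp.supported (ZMod 2) (ZMod 2) S) :
    cone x c ∈ Finsupp.supported (ZMod 2) (ZMod 2) S' :=
  map_mem_supported (fun l hl => by simpa using single_mem_supported (h l hl)) hc

lemma listBoundary_mem_supported (l : List E) :
    listBoundary l ∈ Finsupp.supported (ZMod 2) (ZMod 2)
      {l' | l'.length + 1 = l.length ∧ l'.Sublist l} := by
  induction l with
  | nil => simp [listBoundary]
  | cons x l ih =>
    refine Submodule.add_mem _ (single_mem_supported ⟨by simp, by simp⟩) ?_
    refine cone_mem_supported (S := {l' | l'.length + 1 = l.length ∧ l'.Sublist l}) ?_ ih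
    rintro l' ⟨h1, h2⟩
    exact ⟨by simpa using h1, h2.cons_cons x⟩

lemma eval_congr {F F' : List E → ZMod 2} {S : Set (List E)} (h : ∀ l ∈ S, F l = F' l)
    {c : ListChain E} (hc : c ∈ Finsupp.supported (ZMod 2) (ZMod 2) S) :
    eval F c = eval F' c := by
  simp only [eval, Finsupp.linearCombination_apply, Finsupp.sum]
  refine Finset.sum_congr rfl fun l hl => ?_
  rw [h l (hc hl)]

lemma eval_cone (F : List E → ZMod 2) (x : E) (c : ListChain E) :
    eval F (cone x c) = eval (fun l => F (x :: l)) c := by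
  have : eval F ∘ₗ cone x = eval (fun l => F (x :: l)) := linearMap_ext fun l => by simp
  exact LinearMap.congr_fun this c

lemma eval_map (F : List E' → ZMod 2) (f : E → E') (c : ListChain E) :
    eval F (map f c) = eval (fun l => F (l.map f)) c := by
  have : eval F ∘ₗ map f = eval (fun l => F (l.map f)) := linearMap_ext fun l => by simp
  exact LinearMap.congr_fun this c

/-- The coboundary of a permutation invariant cochain is permutation invariant. -/
lemma eval_listBoundary_perm {l l' : List E} (h : l.Perm l') (F : List E → ZMod 2)
    (hF : ∀ l₁ l₂ : List E, l₁.Perm l₂ → F l₁ = F l₂) :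
    eval F (listBoundary l) = eval F (listBoundary l') := by
  induction h generalizing F with
  | nil => rfl
  | cons x h ih =>
    simp only [listBoundary, map_add, eval_single, eval_cone, hF _ _ h]
    rw [ih _ fun l₁ l₂ hl => hF _ _ (hl.cons x)]
  | swap x y l =>
    simp only [listBoundary, map_add, eval_single, eval_cone, cone_single]
    have : (fun l => F (y :: x :: l)) = fun l => F (x :: y :: l) :=
      funext fun l => hF _ _ (List.Perm.swap _ _ _)
    rw [this]
    ring
  | trans _ _ ih₁ ih₂ => exact (ih₁ F hF).trans (ih₂ F hF)

/-! ### Barycentric subdivision -/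

section Subdivision

variable [NormedAddCommGroup E] [NormedSpace ℝ E]

/-- The barycenter of a list of points. -/
def barycenter (l : List E) : E := (l.length : ℝ)⁻¹ • l.sum

/-- The barycentric subdivision of chains of lists of length `n`. -/
def subdivision : ℕ → ListChain E →ₗ[ZMod 2] ListChain E
  | 0 => LinearMap.id
  | n + 1 => Finsupp.linearCombination (ZMod 2) fun l =>
      cone (barycenter l) (subdivision n (listBoundary l))

lemma subdivision_succ_single (n : ℕ) (l : List E) :
    subdivision (n + 1) (Finsupp.single l 1) =
      cone (barycenter l) (subdivision n (listBoundary l)) := by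
  simp [subdivision]

/-- The boundary of the cone is its base plus a cone over the boundary of the base; the latter
vanishes by induction and `∂∂ = 0`. The index of `subdivision` counts the vertices, so it drops by
one under the boundary. -/
lemma boundary_subdivision (n : ℕ) (c : ListChain E) :
    boundary (subdivision (n + 1) c) = subdivision n (boundary c) := by
  have : boundary ∘ₗ subdivision (E := E) (n + 1) = subdivision n ∘ₗ boundary := by
    refine linearMap_ext fun l => ?_
    simp only [LinearMap.comp_apply, subdivision_succ_single, boundary_cone, boundary_single]
    cases n with
    | zero => simp [subdivision, boundary_listBoundary]
    | succ n => rw [boundary_subdivision n, boundary_listBoundary]; simp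
  exact LinearMap.congr_fun this c

lemma barycenter_map_neg (l : List E) : barycenter (l.map (- ·)) = -barycenter l := by
  have : (l.map (- ·)).sum = -l.sum := by
    induction l with
    | nil => simp
    | cons x l ih => simp [ih, add_comm]
  simp [barycenter, this]

lemma subdivision_map_neg (n : ℕ) (c : ListChain E) :
    subdivision n (map (- ·) c) = map (- ·) (subdivision n c) := by
  induction n generalizing c with
  | zero => rfl
  | succ n ih =>
    have : subdivision (n + 1) ∘ₗ map (- ·) = map (- ·) ∘ₗ subdivision (E := E) (n + 1) := by
      refine linearMap_ext fun l => ?_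
      simp only [LinearMap.comp_apply, subdivision_succ_single, map_single, map_cone,
        barycenter_map_neg, ← ih, map_listBoundary]
    exact LinearMap.congr_fun this c

lemma barycenter_mem_convexHull {l : List E} (hl : l ≠ []) :
    barycenter l ∈ convexHull ℝ {x | x ∈ l} := by
  have hpos : (0 : ℝ) < l.length := by
    exact_mod_cast List.length_pos_iff.2 hl
  have : barycenter l = ∑ i : Fin l.length, (l.length : ℝ)⁻¹ • l[i] := by
    rw [← Finset.smul_sum, barycenter]
    congr 1
    simp
  rw [this]
  refine (convex_convexHull ℝ _).sum_mem (fun _ _ => by positivity) ?_ fun i _ =>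
    subset_convexHull ℝ _ ?_
  · simp [hpos.ne']
  · simp

lemma norm_sum_sub_le {d : ℝ} (v : E) (l : List E) (h : ∀ x ∈ l, dist x v ≤ d) :
    ‖l.sum - (l.length : ℝ) • v‖ ≤ l.length * d := by
  induction l with
  | nil => simp
  | cons x l ih =>
    have h1 := ih fun y hy => h y (List.mem_cons_of_mem _ hy)
    have h2 := h x (by simp)
    rw [dist_eq_norm] at h2
    have : (x :: l).sum - ((x :: l).length : ℝ) • v =
        (x - v) + (l.sum - (l.length : ℝ) • v) := by
      simp only [List.sum_cons, List.length_cons, Nat.cast_add, Nat.cast_one, add_smul, one_smul]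
      abel
    rw [this]
    refine (norm_add_le _ _).trans ?_
    push_cast [List.length_cons]
    linarith

/-- The entry `v` itself contributes nothing to the average of the differences from `v`, which is
where the factor `1 - 1/length` comes from. -/
lemma dist_barycenter_le {d : ℝ} {l : List E} (h : ∀ x ∈ l, ∀ y ∈ l, dist x y ≤ d) {v : E}
    (hv : v ∈ l) : dist (barycenter l) v ≤ (1 - (l.length : ℝ)⁻¹) * d := by
  obtain ⟨s, t, rfl⟩ := List.append_of_mem hv
  have hs := norm_sum_sub_le (d := d) v (s ++ t) fun x hx => h x
    (by rcases List.mem_append.1 hx with hx | hx <;> simp [hx]) v hv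
  have hpos : (0 : ℝ) < (s ++ v :: t).length := by simp; positivity
  set n : ℝ := ((s ++ v :: t).length : ℝ) with hn
  have hlen : ((s ++ t).length : ℝ) = n - 1 := by simp [hn]; ring
  have hsum : (s ++ t).sum - ((s ++ t).length : ℝ) • v = (s ++ v :: t).sum - n • v := by
    rw [hlen, sub_smul, one_smul]
    simp only [List.sum_append, List.sum_cons]
    abel
  rw [hsum, hlen] at hs
  have : barycenter (s ++ v :: t) - v = n⁻¹ • ((s ++ v :: t).sum - n • v) := by
    rw [smul_sub, smul_smul, inv_mul_cancel₀ hpos.ne', one_smul, barycenter]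
  rw [dist_eq_norm, this, norm_smul, Real.norm_of_nonneg (by positivity)]
  calc n⁻¹ * _ ≤ n⁻¹ * ((n - 1) * d) := by gcongr
    _ = _ := by field_simp

/-- The distance from a fixed point is convex, so over a convex hull it is controlled by the
vertices; hence the new barycenter is close to every point of the subdivided faces. The bound `N` on
the number of vertices makes the contraction ratio the same in all dimensions of the induction. -/
lemma subdivision_mem_supported {d : ℝ} (hd : 0 ≤ d) {n N : ℕ} (hn : n ≤ N) {l : List E} (hl : l.length = n)
    (h : ∀ x ∈ l, ∀ y ∈ l, dist x y ≤ d) :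
    subdivision n (Finsupp.single l 1) ∈ Finsupp.supported (ZMod 2) (ZMod 2)
      {l' | l'.length = n ∧ (∀ x ∈ l', x ∈ convexHull ℝ {x | x ∈ l}) ∧
        ∀ x ∈ l', ∀ y ∈ l', dist x y ≤ (1 - (N : ℝ)⁻¹) * d} := by
  induction n generalizing l with
  | zero =>
    have : l = [] := List.length_eq_zero_iff.1 hl
    subst this
    exact single_mem_supported (by simp)
  | succ n ih =>
    have hne : l ≠ [] := by rintro rfl; simp at hl
    have hρ : 1 - ((n + 1 : ℕ) : ℝ)⁻¹ ≤ 1 - (N : ℝ)⁻¹ := by gcongr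
    have hρ0 : 0 ≤ 1 - (N : ℝ)⁻¹ := by
      refine le_trans ?_ hρ
      rw [sub_nonneg]
      exact inv_le_one_of_one_le₀ (by exact_mod_cast Nat.le_add_left 1 n)
    rw [subdivision_succ_single]
    refine cone_mem_supported (S := {l' | l'.length = n ∧
      (∀ x ∈ l', x ∈ convexHull ℝ {x | x ∈ l}) ∧ ∀ x ∈ l', ∀ y ∈ l', dist x y ≤ (1 - (N : ℝ)⁻¹) * d}) ?_ ?_
    · rintro l' ⟨hl1, hl2, hl3⟩
      have hb : ∀ y ∈ l', dist (barycenter l) y ≤ (1 - (N : ℝ)⁻¹) * d := by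
        intro y hy
        obtain ⟨v, hv, hyv⟩ := convexHull_exists_dist_ge (hl2 y hy) (barycenter l)
        rw [dist_comm]
        refine hyv.trans ?_
        rw [dist_comm]
        refine (dist_barycenter_le h hv).trans ?_
        rw [hl]
        gcongr
      refine ⟨by simp [hl1], ?_, ?_⟩
      · intro x hx
        rcases List.mem_cons.1 hx with rfl | hx
        · exact barycenter_mem_convexHull hne
        · exact hl2 x hx
      · intro x hx y hy
        rcases List.mem_cons.1 hx with rfl | hx
        · rcases List.mem_cons.1 hy with rfl | hy
          · rw [dist_self]; positivity
          · exact hb y hy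
        · rcases List.mem_cons.1 hy with rfl | hy
          · rw [dist_comm]; exact hb x hx
          · exact hl3 x hx y hy
    · refine map_mem_supported ?_ (listBoundary_mem_supported l)
      rintro l₁ ⟨h1, h2⟩
      refine Finsupp.supported_mono ?_ (ih (Nat.le_of_succ_le hn) (l := l₁) (by omega)
        fun x hx y hy => h x (h2.subset hx) y (h2.subset hy))
      rintro l' ⟨hl1, hl2, hl3⟩
      exact ⟨hl1, fun x hx => convexHull_mono (fun y hy => h2.subset hy) (hl2 x hx), hl3⟩

end Subdivision

end ListChain

/-! ### Alternating labellings -/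

/-- The indicator of the alternating lists of signs that start with `s`. -/
def alternating : Bool → List Bool → ZMod 2
  | _, [] => 1
  | s, t :: B => if s = t then alternating (!s) B else 0

/-- An alternating list remains alternating with first sign `s` after exactly one deletion: of its
last entry if it starts with `s`, of its first entry otherwise. In a list that does not alternate,
the good deletions come in pairs, since either of two equal neighbours may be removed. -/
lemma eval_alternating_listBoundary (s : Bool) (B : List Bool) :
    ListChain.eval (alternating s) (ListChain.listBoundary B) =
      alternating true B + alternating false B := by
  induction B generalizing s with
  | nil => simp [ListChain.listBoundary, alternating, CharTwo.add_self_eq_zero]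
  | cons t B ih =>
    have key : ListChain.eval (fun l => alternating s (t :: l)) (ListChain.listBoundary B) =
        if s = t then alternating true B + alternating false B else 0 := by
      split_ifs with h
      · rw [← ih (!s)]
        congr 2
        funext l
        simp [alternating, h]
      · have : (fun l => alternating s (t :: l)) = fun _ => 0 := by
          funext l
          simp [alternating, h]
        rw [this]
        simp [ListChain.eval, Finsupp.linearCombination_apply]
    simp only [ListChain.listBoundary, map_add, ListChain.eval_single, ListChain.eval_cone, key]
    cases s <;> cases t <;> simp only [alternating, Bool.not_true, Bool.not_false, if_true,
      reduceCtorEq, if_false] <;> generalize alternating true B = p <;>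
      generalize alternating false B = q <;> revert p q <;> decide

lemma alternating_map_not (s : Bool) (B : List Bool) :
    alternating s (B.map (!·)) = alternating (!s) B := by
  induction B generalizing s with
  | nil => rfl
  | cons t B ih => cases s <;> cases t <;> simp [alternating, ih]

/-- Signed labels, ordered lexicographically. -/
abbrev SignedLabel (m : ℕ) := Fin m ×ₗ Bool

namespace SignedLabel

variable {m : ℕ}

/-- The sign of a label. -/
def sign (a : SignedLabel m) : Bool := (ofLex a).2

/-- The label without its sign. -/
def index (a : SignedLabel m) : Fin m := (ofLex a).1

/-- The opposite label. -/
def opp (a : SignedLabel m) : SignedLabel m := toLex (a.index, !a.sign)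

@[simp] lemma index_opp (a : SignedLabel m) : a.opp.index = a.index := rfl

@[simp] lemma sign_opp (a : SignedLabel m) : a.opp.sign = !a.sign := rfl

lemma ext {a b : SignedLabel m} (h : a.index = b.index) (h' : a.sign = b.sign) : a = b :=
  ofLex.injective (Prod.ext h h')

lemma le_iff {a b : SignedLabel m} :
    a ≤ b ↔ a.index < b.index ∨ a.index = b.index ∧ a.sign ≤ b.sign :=
  Prod.Lex.le_iff

/-- No two entries of the list are opposite to each other. -/
def Compatible (L : List (SignedLabel m)) : Prop :=
  ∀ a ∈ L, ∀ b ∈ L, a.index = b.index → a = b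

/-- The indicator of the lists of labels whose signs alternate, starting with `s`, when the list
is sorted. -/
def sortedAlternating (s : Bool) (L : List (SignedLabel m)) : ZMod 2 :=
  alternating s ((L.insertionSort (· ≤ ·)).map sign)

lemma sortedAlternating_perm (s : Bool) {L L' : List (SignedLabel m)} (h : L.Perm L') :
    sortedAlternating s L = sortedAlternating s L' := by
  have : L.insertionSort (· ≤ ·) = L'.insertionSort (· ≤ ·) :=
    List.Perm.eq_of_pairwise (le := (· ≤ ·)) (fun a b _ _ h1 h2 => le_antisymm h1 h2)
      (List.pairwise_insertionSort _ _) (List.pairwise_insertionSort _ _)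
      (((List.perm_insertionSort _ L).trans h).trans (List.perm_insertionSort _ L').symm)
  rw [sortedAlternating, sortedAlternating, this]

/-- By permutation invariance the list may be sorted beforehand; its faces are then sorted too, and
only the signs matter. -/
lemma eval_sortedAlternating_listBoundary (s : Bool) (L : List (SignedLabel m)) :
    ListChain.eval (sortedAlternating s) (ListChain.listBoundary L) =
      sortedAlternating true L + sortedAlternating false L := by
  rw [ListChain.eval_listBoundary_perm (List.perm_insertionSort (· ≤ ·) L).symm _
    fun _ _ => sortedAlternating_perm s]
  rw [ListChain.eval_congr (F' := fun l => alternating s (l.map sign)) ?_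
    (ListChain.listBoundary_mem_supported _)]
  · rw [← ListChain.eval_map, ListChain.map_listBoundary, eval_alternating_listBoundary]
    rfl
  · rintro l ⟨-, hl⟩
    rw [sortedAlternating, List.Pairwise.insertionSort_eq]
    exact (List.pairwise_insertionSort _ L).sublist hl

/-- The order compares indices first, and in a compatible list equal indices mean equal labels, so
`opp` preserves the order and merely flips the signs. -/
lemma sortedAlternating_map_opp (s : Bool) {L : List (SignedLabel m)} (hL : Compatible L) :
    sortedAlternating s (L.map opp) = sortedAlternating (!s) L := by
  rw [sortedAlternating, ← List.map_insertionSort (· ≤ ·) (· ≤ ·) opp L, List.map_map,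
    sortedAlternating, ← alternating_map_not, List.map_map]
  · rfl
  · intro a ha b hb
    rw [le_iff, le_iff]
    by_cases h : a.index = b.index
    · simp [hL a ha b hb h]
    · simp [h]

/-- Neighbours with equal index would be equal labels, against the alternation of signs. So the
indices increase strictly along the sorted list. -/
lemma length_le_of_sortedAlternating_ne_zero {s : Bool} {L : List (SignedLabel m)}
    (hL : Compatible L) (h : sortedAlternating s L ≠ 0) : L.length ≤ m := by
  have key : ∀ (M : List (SignedLabel m)) (s : Bool), M.Pairwise (· ≤ ·) → Compatible M →
      alternating s (M.map sign) ≠ 0 → (M.map index).Pairwise (· < ·) ∧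
        ∀ a ∈ M.head?, a.sign = s := by
    intro M
    induction M with
    | nil => simp
    | cons a M ih =>
      intro s h1 h2 h3
      rw [List.pairwise_cons] at h1
      simp only [List.map_cons, alternating, ne_eq, ite_eq_right_iff, Classical.not_imp] at h3
      obtain ⟨rfl, h3⟩ := h3
      obtain ⟨ih1, ih2⟩ := ih _ h1.2
        (fun b hb c hc => h2 b (List.mem_cons_of_mem _ hb) c (List.mem_cons_of_mem _ hc)) h3
      refine ⟨?_, by simp⟩
      cases M with
      | nil => simp
      | cons b M =>
        have hab : a.index < b.index := by
          rcases le_iff.1 (h1.1 b (by simp)) with h | ⟨h, -⟩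
          · exact h
          · have := h2 a (by simp) b (by simp) h
            have hs := ih2 b (by simp)
            rw [this] at hs
            simp at hs
        simp only [List.map_cons, List.pairwise_cons] at ih1 ⊢
        refine ⟨?_, ih1⟩
        intro c hc
        rcases List.mem_cons.1 hc with rfl | hc
        · exact hab
        · exact hab.trans (ih1.1 c hc)
  have hperm := List.perm_insertionSort (· ≤ ·) L
  obtain ⟨h1, -⟩ := key _ s (List.pairwise_insertionSort _ L)
    (fun a ha b hb => hL a (hperm.subset ha) b (hperm.subset hb)) h
  have hnodup : ((L.insertionSort (· ≤ ·)).map index).Nodup := h1.imp fun h => ne_of_lt h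
  have := hnodup.length_le_card
  simpa using this

end SignedLabel

open SignedLabel in
/-- A form of Tucker's lemma for chains of hemispheres. -/
theorem tucker {E : Type*} [InvolutiveNeg E] {m n : ℕ} (H : ℕ → ListChain E)
    (h0 : ListChain.boundary (H 0) = Finsupp.single [] 1)
    (hs : ∀ i, i < n → ListChain.boundary (H (i + 1)) = H i + ListChain.map (- ·) (H i))
    (lab : E → SignedLabel m)
    (hlab : ∀ i, i ≤ n → H i ∈ Finsupp.supported (ZMod 2) (ZMod 2)
      {l | l.length = i + 1 ∧ (∀ x ∈ l, lab (-x) = (lab x).opp) ∧ Compatible (l.map lab)}) :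
    n + 1 ≤ m := by
  have hcob : ∀ (s : Bool) (c : ListChain E),
      ListChain.eval (fun l => sortedAlternating s (l.map lab)) (ListChain.boundary c) =
        ListChain.eval (fun l => sortedAlternating true (l.map lab)) c +
          ListChain.eval (fun l => sortedAlternating false (l.map lab)) c := by
    intro s c
    have : ListChain.eval (fun l => sortedAlternating s (l.map lab)) ∘ₗ ListChain.boundary =
        ListChain.eval (fun l => sortedAlternating true (l.map lab)) +
          ListChain.eval (fun l => sortedAlternating false (l.map lab)) := by
      refine ListChain.linearMap_ext fun l => ?_
      simp [← ListChain.eval_map, ListChain.map_listBoundary,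
        eval_sortedAlternating_listBoundary]
    exact LinearMap.congr_fun this c
  -- The number of alternating simplices of `H i`, of both initial signs together, is odd. By `hcob`
  -- the count for `H (i + 1)` is that of the positive ones in `H i` and its antipode, and the
  -- positive ones in the antipode correspond to negative ones in `H i`. The count starts from the
  -- single empty face of `H 0`.
  have hodd : ∀ i, i ≤ n → ListChain.eval (fun l => sortedAlternating true (l.map lab)) (H i) +
      ListChain.eval (fun l => sortedAlternating false (l.map lab)) (H i) = 1 := by
    intro i hi
    induction i with
    | zero =>
      rw [← hcob true, h0]
      simp [sortedAlternating, alternating]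
    | succ i ih =>
      rw [← hcob true, hs i (by omega), map_add, ListChain.eval_map, ← ih (by omega)]
      congr 1
      refine ListChain.eval_congr ?_ (hlab i (by omega))
      rintro l ⟨-, hl1, hl2⟩
      have : (l.map (- ·)).map lab = (l.map lab).map opp := by
        simpa using hl1
      rw [this, sortedAlternating_map_opp _ hl2]
      rfl
  by_contra! hm
  have hzero : ∀ s, ListChain.eval (fun l => sortedAlternating s (l.map lab)) (H n) = 0 := by
    intro s
    rw [ListChain.eval_congr (F' := fun _ => 0) ?_ (hlab n le_rfl)]
    · simp [ListChain.eval, Finsupp.linearCombination_apply]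
    · rintro l ⟨hl, -, hl2⟩
      by_contra hne
      have := length_le_of_sortedAlternating_ne_zero hl2 hne
      simp [hl] at this
      omega
  have := hodd n le_rfl
  rw [hzero, hzero] at this
  simp at this

/-! ### The Borsuk–Ulam theorem -/

/-- Chains of hemispheres in the boundary of the cross-polytope with vertices `± e i`. -/
def crossPolytopeChain {E : Type*} [Neg E] (e : ℕ → E) : ℕ → ListChain E
  | 0 => Finsupp.single [e 0] 1
  | n + 1 => ListChain.cone (e (n + 1))
      (crossPolytopeChain e n + ListChain.map (- ·) (crossPolytopeChain e n))

lemma ListChain.map_neg_map_neg {E : Type*} [InvolutiveNeg E] (c : ListChain E) :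
    ListChain.map (- ·) (ListChain.map (- ·) c) = c := by
  have : ListChain.map (- ·) ∘ₗ ListChain.map (- ·) = (LinearMap.id : ListChain E →ₗ[ZMod 2] _) :=
    ListChain.linearMap_ext fun l => by simp
  exact LinearMap.congr_fun this c

lemma boundary_crossPolytopeChain_zero {E : Type*} [Neg E] (e : ℕ → E) :
    ListChain.boundary (crossPolytopeChain e 0) = Finsupp.single [] 1 := by
  simp [crossPolytopeChain, ListChain.listBoundary]

lemma boundary_crossPolytopeChain_succ {E : Type*} [InvolutiveNeg E] (e : ℕ → E) (n : ℕ) :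
    ListChain.boundary (crossPolytopeChain e (n + 1)) =
      crossPolytopeChain e n + ListChain.map (- ·) (crossPolytopeChain e n) := by
  rw [crossPolytopeChain, ListChain.boundary_cone, add_eq_left]
  have : ListChain.boundary
      (crossPolytopeChain e n + ListChain.map (- ·) (crossPolytopeChain e n)) = 0 := by
    rw [map_add, ListChain.boundary_map]
    cases n with
    | zero =>
      rw [boundary_crossPolytopeChain_zero, ListChain.map_single, List.map_nil,
        ZModModule.add_self]
    | succ n =>
      rw [boundary_crossPolytopeChain_succ, map_add, ListChain.map_neg_map_neg,
        add_comm (ListChain.map _ _), ZModModule.add_self]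
  rw [this, map_zero]

section

variable {k : ℕ}

/-- The lists of `n` points of mutual distance at most `δ` on a common supporting hyperplane of
the cross-polytope. -/
def smallFaceLists (k n : ℕ) (δ : ℝ) : Set (List (Fin k → ℝ)) :=
  {l | l.length = n ∧ (∃ s : Fin k → ℝ, (∀ i, |s i| ≤ 1) ∧
    ∀ x ∈ l, ∑ i, s i * x i = 1 ∧ ‖x‖ ≤ 1) ∧ ∀ x ∈ l, ∀ y ∈ l, dist x y ≤ δ}

/-- The functional `s` witnesses that a simplex lies on a face of the cross-polytope. The vanishing
of the later coordinates allows entry `n + 1` of `s` to be reset to 1 when the new vertex is added.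
-/
lemma crossPolytopeChain_mem_supported (n : ℕ) (hn : n < k) :
    crossPolytopeChain (fun n => if h : n < k then Pi.single ⟨n, h⟩ 1 else 0 : ℕ → Fin k → ℝ) n ∈
      Finsupp.supported (ZMod 2) (ZMod 2) {l : List (Fin k → ℝ) | l.length = n + 1 ∧
        ∃ s : Fin k → ℝ, (∀ i, |s i| ≤ 1) ∧ ∀ x ∈ l, ∑ i, s i * x i = 1 ∧ ‖x‖ ≤ 1 ∧
          ∀ j : Fin k, n < j → x j = 0} := by
  have hnorm : ∀ i : Fin k, ‖(Pi.single i 1 : Fin k → ℝ)‖ ≤ 1 := fun i => by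
    rw [pi_norm_le_iff_of_nonneg zero_le_one]
    intro j
    by_cases h : j = i <;> simp [h]
  induction n with
  | zero =>
    refine ListChain.single_mem_supported ⟨rfl, fun _ => 1, by simp, ?_⟩
    intro x hx
    rw [List.mem_singleton] at hx
    subst hx
    simp only [hn, dite_true]
    refine ⟨by simp, hnorm _, fun j hj => ?_⟩
    rw [Pi.single_eq_of_ne]
    rintro rfl
    simp at hj
  | succ n ih =>
    have ih := ih (by omega)
    refine ListChain.cone_mem_supported (S := {l | l.length = n + 1 ∧
        ∃ s : Fin k → ℝ, (∀ i, |s i| ≤ 1) ∧ ∀ x ∈ l, ∑ i, s i * x i = 1 ∧ ‖x‖ ≤ 1 ∧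
          ∀ j : Fin k, n < j → x j = 0}) ?_ ?_
    · rintro l ⟨h1, s, h2, h3⟩
      refine ⟨by simp [h1], Function.update s ⟨n + 1, hn⟩ 1, ?_, ?_⟩
      · intro i
        by_cases h : i = ⟨n + 1, hn⟩
        · simp [h]
        · simp [h, h2]
      · intro x hx
        rcases List.mem_cons.1 hx with rfl | hx
        · simp only [hn, dite_true]
          refine ⟨by simp [Pi.single_apply], hnorm _, fun j hj => ?_⟩
          rw [Pi.single_eq_of_ne]
          rintro rfl
          exact lt_irrefl _ hj
        · obtain ⟨h4, h5, h6⟩ := h3 x hx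
          refine ⟨?_, h5, fun j hj => h6 j (by omega)⟩
          rw [← h4]
          refine Finset.sum_congr rfl fun i _ => ?_
          by_cases h : i = ⟨n + 1, hn⟩
          · have : x i = 0 := h6 i (by simp [h])
            simp [this]
          · simp [h]
    · refine Submodule.add_mem _ ih (ListChain.map_mem_supported ?_ ih)
      rintro l ⟨h1, s, h2, h3⟩
      rw [ListChain.map_single]
      refine ListChain.single_mem_supported ⟨by simpa using h1, fun i => -s i, by simpa using h2, ?_⟩
      intro x hx
      obtain ⟨y, hy, rfl⟩ := List.mem_map.1 hx
      obtain ⟨h4, h5, h6⟩ := h3 y hy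
      exact ⟨by simpa using h4, by simpa using h5, fun j hj => by simp [h6 j hj]⟩

lemma subdivision_mem_smallFaceLists {n : ℕ} (hn : n ≤ k) {δ : ℝ} (hδ : 0 ≤ δ)
    {c : ListChain (Fin k → ℝ)}
    (hc : c ∈ Finsupp.supported (ZMod 2) (ZMod 2) (smallFaceLists k n δ)) :
    ListChain.subdivision n c ∈ Finsupp.supported (ZMod 2) (ZMod 2)
      (smallFaceLists k n ((1 - (k : ℝ)⁻¹) * δ)) := by
  refine ListChain.map_mem_supported ?_ hc
  rintro l ⟨h1, ⟨s, hs, h2⟩, h3⟩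
  refine Finsupp.supported_mono ?_ (ListChain.subdivision_mem_supported hδ hn h1 h3)
  rintro l' ⟨h1', h2', h3'⟩
  refine ⟨h1', ⟨s, hs, fun x hx => ?_⟩, h3'⟩
  have hconv : Convex ℝ {x : Fin k → ℝ | ∑ i, s i * x i = 1 ∧ ‖x‖ ≤ 1} := by
    have hlin : IsLinearMap ℝ fun x : Fin k → ℝ => ∑ i, s i * x i :=
      ⟨fun x y => by simp [mul_add, Finset.sum_add_distrib], fun a x => by
        simp only [Pi.smul_apply, smul_eq_mul, Finset.mul_sum]
        exact Finset.sum_congr rfl fun i _ => by ring⟩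
    refine (convex_hyperplane hlin 1).inter ?_
    have h := convex_closedBall (0 : Fin k → ℝ) 1
    have h' : Metric.closedBall (0 : Fin k → ℝ) 1 = {x | ‖x‖ ≤ 1} := by
      ext x
      exact mem_closedBall_zero_iff
    rwa [h'] at h
  exact convexHull_min (fun y hy => h2 y hy) hconv (h2' x hx)

lemma iterate_subdivision_mem_smallFaceLists {n : ℕ} (hn : n < k) (r : ℕ) :
    (ListChain.subdivision (n + 1))^[r]
      (crossPolytopeChain (fun n => if h : n < k then Pi.single ⟨n, h⟩ 1 else 0 : ℕ → Fin k → ℝ) n)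
      ∈ Finsupp.supported (ZMod 2) (ZMod 2)
        (smallFaceLists k (n + 1) ((1 - (k : ℝ)⁻¹) ^ r * 2)) := by
  have hρ : 0 ≤ 1 - (k : ℝ)⁻¹ := by
    rw [sub_nonneg]
    exact inv_le_one_of_one_le₀ (by exact_mod_cast (by omega : 1 ≤ k))
  induction r with
  | zero =>
    refine Finsupp.supported_mono ?_ (crossPolytopeChain_mem_supported n hn)
    rintro l ⟨h1, s, h2, h3⟩
    refine ⟨h1, ⟨s, h2, fun x hx => ⟨(h3 x hx).1, (h3 x hx).2.1⟩⟩, fun x hx y hy => ?_⟩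
    rw [dist_eq_norm]
    have := norm_sub_le x y
    linarith [(h3 x hx).2.1, (h3 y hy).2.1]
  | succ r ih =>
    rw [Function.iterate_succ_apply', pow_succ', mul_assoc]
    exact subdivision_mem_smallFaceLists hn (by positivity) ih

/-- This keeps all subdivided simplices inside a compact shell away from the origin, where the
radial extension of the odd map is uniformly continuous. -/
lemma inv_le_norm_of_sum_eq_one (hk : 0 < k) {s x : Fin k → ℝ} (hs : ∀ i, |s i| ≤ 1)
    (h : ∑ i, s i * x i = 1) : (k : ℝ)⁻¹ ≤ ‖x‖ := by
  have hk' : (0 : ℝ) < k := by exact_mod_cast hk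
  rw [inv_le_iff_one_le_mul₀ hk', ← h]
  calc ∑ i, s i * x i ≤ ∑ _i : Fin k, ‖x‖ := Finset.sum_le_sum fun i _ => by
        calc s i * x i ≤ |s i * x i| := le_abs_self _
          _ = |s i| * ‖x i‖ := by rw [abs_mul, Real.norm_eq_abs]
          _ ≤ 1 * ‖x‖ := mul_le_mul (hs i) (norm_le_pi_norm x i) (norm_nonneg _) zero_le_one
          _ = ‖x‖ := one_mul _
    _ = ‖x‖ * k := by simp [mul_comm]

open SignedLabel in
/-- The Borsuk–Ulam theorem: there is no odd continuous map from the unit sphere of the maximum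
norm of `ℝ^k` to `ℝ^m ∖ {0}` with `m < k`. -/
theorem borsuk_ulam {m : ℕ} (f : (Fin k → ℝ) → (Fin m → ℝ))
    (hf : ContinuousOn f (Metric.sphere 0 1)) (hodd : ∀ x ∈ Metric.sphere 0 1, f (-x) = -f x)
    (hne : ∀ x ∈ Metric.sphere 0 1, f x ≠ 0) : k ≤ m := by
  rcases Nat.eq_zero_or_pos k with rfl | hk
  · exact Nat.zero_le m
  have hk' : (0 : ℝ) < k := by exact_mod_cast hk
  have hm : Nonempty (Fin m) := by
    rw [← not_isEmpty_iff]
    intro hm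
    have : (fun _ => 1 : Fin k → ℝ) ∈ Metric.sphere (0 : Fin k → ℝ) 1 := by
      have : Nonempty (Fin k) := ⟨⟨0, hk⟩⟩
      rw [mem_sphere_zero_iff_norm, pi_norm_const]
      simp
    exact hne _ this (Subsingleton.elim _ _)
  set g : (Fin k → ℝ) → (Fin m → ℝ) := fun x => f (‖x‖⁻¹ • x) with hg
  have hsph : ∀ x : Fin k → ℝ, x ≠ 0 → ‖x‖⁻¹ • x ∈ Metric.sphere (0 : Fin k → ℝ) 1 := by
    intro x hx
    rw [mem_sphere_zero_iff_norm, norm_smul, norm_inv, norm_norm,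
      inv_mul_cancel₀ (norm_ne_zero_iff.2 hx)]
  have hgneg : ∀ x, x ≠ 0 → g (-x) = -g x := by
    intro x hx
    simp only [hg, norm_neg, smul_neg]
    exact hodd _ (hsph x hx)
  have hgne : ∀ x, x ≠ 0 → g x ≠ 0 := fun x hx => hne _ (hsph x hx)
  set K : Set (Fin k → ℝ) := Metric.closedBall 0 1 ∩ {x | (k : ℝ)⁻¹ ≤ ‖x‖} with hK
  have hKne : ∀ x ∈ K, x ≠ 0 := by
    rintro x ⟨-, hx⟩ rfl
    rw [Set.mem_ofPred_eq, norm_zero] at hx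
    exact absurd hx (not_le.2 (by positivity))
  have hKc : IsCompact K :=
    (isCompact_closedBall 0 1).inter_right (isClosed_le continuous_const continuous_norm)
  have hgc : ContinuousOn g K := by
    refine hf.comp (ContinuousOn.smul (ContinuousOn.inv₀ continuous_norm.continuousOn ?_)
      continuousOn_id) fun x hx => hsph x (hKne x hx)
    exact fun x hx => norm_ne_zero_iff.2 (hKne x hx)
  obtain ⟨η, hη, hgη⟩ : ∃ η > 0, ∀ x ∈ K, η ≤ ‖g x‖ := by
    rcases K.eq_empty_or_nonempty with h | h
    · exact ⟨1, one_pos, by simp [h]⟩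
    · obtain ⟨x, hx, hmin⟩ := hKc.exists_isMinOn h hgc.norm
      exact ⟨‖g x‖, norm_pos_iff.2 (hgne x (hKne x hx)), fun y hy => hmin hy⟩
  obtain ⟨δ, hδ, hgδ⟩ := Metric.uniformContinuousOn_iff.1
    (hKc.uniformContinuousOn_of_continuous hgc) η hη
  have hmax : ∀ u : Fin m → ℝ, ∃ j, ∀ i, u i ≤ u j := fun u => Finite.exists_max u
  choose top htop using hmax
  have htopnorm : ∀ u : Fin m → ℝ, ‖u‖ = |u (top fun i => |u i|)| := by
    intro u
    refine le_antisymm ?_ (norm_le_pi_norm u _)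
    rw [pi_norm_le_iff_of_nonneg (abs_nonneg _)]
    exact htop fun i => |u i|
  -- The label records a coordinate of `g x` of largest modulus and its sign. The choice depends
  -- only on the moduli, so antipodal points select the same coordinate.
  set lab : (Fin k → ℝ) → SignedLabel m := fun x =>
    toLex (top fun i => |g x i|, decide (0 < g x (top fun i => |g x i|))) with hlab
  have hlabneg : ∀ x, x ≠ 0 → lab (-x) = (lab x).opp := by
    intro x hx
    have h1 : (fun i => |g (-x) i|) = fun i => |g x i| := by
      funext i
      simp [hgneg x hx]
    have h2 : g x (top fun i => |g x i|) ≠ 0 := by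
      have := htopnorm (g x)
      intro h
      rw [h, abs_zero, norm_eq_zero] at this
      exact hgne x hx this
    refine SignedLabel.ext ?_ ?_
    · simp only [hlab, SignedLabel.index, h1]
      rfl
    · simp only [hlab, SignedLabel.sign_opp]
      simp only [SignedLabel.sign, h1, ofLex_toLex]
      simp only [hgneg x hx, Pi.neg_apply, Left.neg_pos_iff]
      rw [← decide_not, decide_eq_decide, not_lt]
      exact ⟨le_of_lt, fun h => lt_of_le_of_ne h h2⟩
  have hclose : ∀ x ∈ K, ∀ y ∈ K, dist x y < δ → (lab x).index = (lab y).index →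
      lab x = lab y := by
    intro x hx y hy hxy hind
    refine SignedLabel.ext hind ?_
    have hd := hgδ x hx y hy hxy
    have h1 := hgη x hx
    have h2 := hgη y hy
    rw [htopnorm] at h1 h2
    simp only [hlab, SignedLabel.index, ofLex_toLex] at hind
    simp only [hlab, SignedLabel.sign, ofLex_toLex]
    rw [← hind] at h2 ⊢
    set j := top fun i => |g x i|
    -- At this common coordinate both moduli are at least `η`, so opposite signs would force a
    -- difference of at least `2η`.
    have h3 : |g x j - g y j| < η := lt_of_le_of_lt (dist_le_pi_dist (g x) (g y) j) hd
    rw [decide_eq_decide]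
    rw [abs_lt] at h3
    constructor
    · intro hpos
      rw [abs_of_pos hpos] at h1
      linarith
    · intro hpos
      rw [abs_of_pos hpos] at h2
      linarith
  have hρ : 0 ≤ 1 - (k : ℝ)⁻¹ := by
    rw [sub_nonneg]
    exact inv_le_one_of_one_le₀ (by exact_mod_cast (by omega : 1 ≤ k))
  obtain ⟨r, hr⟩ : ∃ r : ℕ, (1 - (k : ℝ)⁻¹) ^ r * 2 < δ := by
    obtain ⟨r, hr⟩ := exists_pow_lt_of_lt_one (half_pos hδ)
      (by simpa using hk' : 1 - (k : ℝ)⁻¹ < 1)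
    exact ⟨r, by linarith⟩
  set e : ℕ → Fin k → ℝ := fun n => if h : n < k then Pi.single ⟨n, h⟩ 1 else 0 with he
  have hbd : ∀ (n r : ℕ) (c : ListChain (Fin k → ℝ)),
      ListChain.boundary ((ListChain.subdivision (n + 1))^[r] c) =
        (ListChain.subdivision n)^[r] (ListChain.boundary c) := by
    intro n r
    induction r with
    | zero => simp
    | succ r ih => intro c; rw [Function.iterate_succ_apply, ih, ListChain.boundary_subdivision]; rfl
  have hneg : ∀ (n r : ℕ) (c : ListChain (Fin k → ℝ)),
      (ListChain.subdivision n)^[r] (ListChain.map (- ·) c) =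
        ListChain.map (- ·) ((ListChain.subdivision n)^[r] c) := by
    intro n r
    induction r with
    | zero => simp
    | succ r ih =>
      intro c
      rw [Function.iterate_succ_apply, ListChain.subdivision_map_neg, ih]
      rfl
  have := tucker (n := k - 1) (fun n => (ListChain.subdivision (n + 1))^[r] (crossPolytopeChain e n))
    ?_ ?_ lab ?_
  · omega
  · rw [hbd, boundary_crossPolytopeChain_zero]
    exact Function.iterate_fixed rfl r
  · intro i _
    rw [hbd, boundary_crossPolytopeChain_succ, iterate_map_add, hneg]
  · intro i hi
    refine Finsupp.supported_mono ?_ (iterate_subdivision_mem_smallFaceLists (by omega : i < k) r)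
    rintro l ⟨h1, ⟨s, hs, h2⟩, h3⟩
    have hlK : ∀ x ∈ l, x ∈ K := fun x hx =>
      ⟨mem_closedBall_zero_iff.2 (h2 x hx).2, inv_le_norm_of_sum_eq_one hk hs (h2 x hx).1⟩
    refine ⟨h1, fun x hx => hlabneg x (hKne x (hlK x hx)), ?_⟩
    intro a ha b hb hab
    obtain ⟨x, hx, rfl⟩ := List.mem_map.1 ha
    obtain ⟨y, hy, rfl⟩ := List.mem_map.1 hb
    exact hclose x (hlK x hx) y (hlK y hy) ((h3 x hx y hy).trans_lt hr) hab

end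

/-! ### Step functions, multi-way cuts and the genus -/

open Classical in
/-- The function with the value `t a` on `P a` and the value `0` outside of all the `P a`. -/
def stepFunction {V : Type*} {k : ℕ} (P : Fin k → Finset V) (t : Fin k → ℝ) : V → ℝ :=
  fun v => ∑ a, if v ∈ P a then t a else 0

/-- The vector of signs that is positive exactly on `S`. -/
def signVector {k : ℕ} (S : Finset (Fin k)) : Fin k → ℝ := fun a => if a ∈ S then 1 else -1

section StepFunction

variable {V : Type*} {k : ℕ} {P : Fin k → Finset V}

lemma stepFunction_of_mem (hP : ∀ i j, i ≠ j → Disjoint (P i) (P j)) (t : Fin k → ℝ) {a : Fin k}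
    {v : V} (hv : v ∈ P a) : stepFunction P t v = t a := by
  rw [stepFunction, Finset.sum_eq_single a]
  · simp [hv]
  · intro b _ hb
    rw [if_neg]
    exact fun hvb => Finset.disjoint_left.1 (hP b a hb) hvb hv
  · simp

lemma stepFunction_of_notMem (t : Fin k → ℝ) {v : V} (hv : ∀ a, v ∉ P a) :
    stepFunction P t v = 0 := by
  simp [stepFunction, hv]

lemma stepFunction_add (s t : Fin k → ℝ) :
    stepFunction P (s + t) = stepFunction P s + stepFunction P t := by
  funext v
  simp only [stepFunction, Pi.add_apply, ← Finset.sum_add_distrib]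
  exact Finset.sum_congr rfl fun a _ => by split_ifs <;> simp

lemma stepFunction_smul (c : ℝ) (t : Fin k → ℝ) :
    stepFunction P (c • t) = c • stepFunction P t := by
  funext v
  simp only [stepFunction, Pi.smul_apply, smul_eq_mul, Finset.mul_sum]
  exact Finset.sum_congr rfl fun a _ => by split_ifs <;> simp

lemma stepFunction_neg (t : Fin k → ℝ) : stepFunction P (-t) = -stepFunction P t := by
  have := stepFunction_smul (P := P) (-1) t
  simpa using this

lemma continuous_stepFunction : Continuous (stepFunction P) := by
  refine continuous_pi fun v => continuous_finsetSum _ fun a _ => ?_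
  split_ifs
  · exact continuous_apply a
  · exact continuous_const

lemma norm_stepFunction [Fintype V] (hP : ∀ i j, i ≠ j → Disjoint (P i) (P j))
    (hne : ∀ i, (P i).Nonempty) (t : Fin k → ℝ) : ‖stepFunction P t‖ = ‖t‖ := by
  apply le_antisymm
  · rw [pi_norm_le_iff_of_nonneg (norm_nonneg _)]
    intro v
    by_cases h : ∃ a, v ∈ P a
    · obtain ⟨a, ha⟩ := h
      rw [stepFunction_of_mem hP t ha]
      exact norm_le_pi_norm t a
    · push Not at h
      rw [stepFunction_of_notMem t h, norm_zero]
      exact norm_nonneg _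
  · rw [pi_norm_le_iff_of_nonneg (norm_nonneg _)]
    intro a
    obtain ⟨v, hv⟩ := hne a
    rw [← stepFunction_of_mem hP t hv]
    exact norm_le_pi_norm _ v

end StepFunction

lemma le_krasnoselskiiGenus_iff {V : Type*} {A : Set (V → ℝ)} {k : ℕ} :
    (k : ℕ∞) ≤ krasnoselskiiGenus A ↔ ∀ (m : ℕ) (f : (V → ℝ) → (Fin m → ℝ)),
      ContinuousOn f A → (∀ x ∈ A, f (-x) = -f x) → (∀ x ∈ A, f x ≠ 0) → k ≤ m := by
  simp only [krasnoselskiiGenus, le_iInf_iff, Nat.cast_le]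
  exact ⟨fun h m f h1 h2 h3 => h m ⟨f, h1, h2, h3⟩,
    fun h m ⟨f, h1, h2, h3⟩ => h m f h1 h2 h3⟩

/-- An odd map on the image, composed with the odd map `stepFunction P`, is an odd map on the sphere
of `ℝ^k`, to which `borsuk_ulam` applies. -/
lemma le_krasnoselskiiGenus_image_stepFunction {V : Type*} {k : ℕ} (P : Fin k → Finset V) :
    (k : ℕ∞) ≤ krasnoselskiiGenus (stepFunction P '' Metric.sphere 0 1) := by
  rw [le_krasnoselskiiGenus_iff]
  intro m f h1 h2 h3
  refine borsuk_ulam (fun t => f (stepFunction P t))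
    (h1.comp continuous_stepFunction.continuousOn fun t ht => Set.mem_image_of_mem _ ht) ?_ ?_
  · intro t ht
    rw [stepFunction_neg]
    exact h2 _ (Set.mem_image_of_mem _ ht)
  · exact fun t ht => h3 _ (Set.mem_image_of_mem _ ht)

/-! ### Total variation: convexity and values on step functions. -/

namespace WeightedGraph

variable {V : Type*} (G : WeightedGraph V)

lemma w_nonneg (i j : V) : 0 ≤ G.w i j := by
  by_cases h : G.toSimpleGraph.Adj i j
  · exact (G.w_pos i j h).le
  · exact (G.w_zero i j h).ge

lemma cutWeight_comm (A B : Finset V) : G.cutWeight A B = G.cutWeight B A := by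
  rw [cutWeight, cutWeight, Finset.sum_comm]
  simp only [G.w_symm]

variable [Fintype V]

lemma totalVariation_nonneg (x : V → ℝ) : 0 ≤ G.totalVariation x :=
  div_nonneg (Finset.sum_nonneg fun i _ => Finset.sum_nonneg fun j _ =>
    mul_nonneg (G.w_nonneg i j) (abs_nonneg _)) zero_le_two

lemma continuous_totalVariation : Continuous G.totalVariation := by
  unfold totalVariation
  fun_prop

lemma totalVariation_le_of_adj {x y : V → ℝ}
    (h : ∀ i j, G.toSimpleGraph.Adj i j → |x i - x j| ≤ |y i - y j|) :
    G.totalVariation x ≤ G.totalVariation y := by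
  unfold totalVariation
  gcongr (∑ i, ∑ j, ?_) / 2 with i _ j _
  by_cases hij : G.toSimpleGraph.Adj i j
  · exact mul_le_mul_of_nonneg_left (h i j hij) (G.w_nonneg i j)
  · simp [G.w_zero i j hij]

lemma convexOn_totalVariation : ConvexOn ℝ Set.univ G.totalVariation := by
  refine ⟨convex_univ, fun x _ y _ a b ha hb _ => ?_⟩
  have : a • G.totalVariation x + b • G.totalVariation y =
      (∑ i, ∑ j, G.w i j * (a * |x i - x j| + b * |y i - y j|)) / 2 := by
    simp only [totalVariation, smul_eq_mul, mul_add, Finset.sum_add_distrib, add_div,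
      mul_div_assoc', Finset.mul_sum]
    congr 3 <;> funext i <;> exact Finset.sum_congr rfl fun j _ => by ring
  rw [this, totalVariation]
  gcongr (∑ i, ∑ j, ?_) / 2 with i _ j _
  refine mul_le_mul_of_nonneg_left ?_ (G.w_nonneg i j)
  calc |(a • x + b • y) i - (a • x + b • y) j| = |a * (x i - x j) + b * (y i - y j)| := by
        congr 1
        simp only [Pi.add_apply, Pi.smul_apply, smul_eq_mul]
        ring
    _ ≤ |a * (x i - x j)| + |b * (y i - y j)| := abs_add_le _ _
    _ = _ := by rw [abs_mul, abs_mul, abs_of_nonneg ha, abs_of_nonneg hb]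

section MultiCut

variable {k : ℕ} {P : Fin k → Finset V}

open Classical in
lemma sum_eq_sum_blocks (hP : ∀ i j, i ≠ j → Disjoint (P i) (P j)) (F : V → ℝ) :
    ∑ v, F v = ∑ a, ∑ v ∈ P a, F v +
      ∑ v ∈ Finset.univ.filter (fun v => ∀ j, v ∉ P j), F v := by
  rw [← Finset.sum_biUnion fun a _ b _ hab => hP a b hab,
    ← Finset.sum_union]
  · congr 1
    ext v
    simp only [Finset.mem_univ, Finset.mem_union, Finset.mem_biUnion, Finset.mem_filter, true_and,
      true_iff]
    by_cases h : ∃ a, v ∈ P a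
    · exact Or.inl h
    · exact Or.inr (not_exists.1 h)
  · rw [Finset.disjoint_left]
    intro v hv hv'
    obtain ⟨a, -, ha⟩ := Finset.mem_biUnion.1 hv
    exact (Finset.mem_filter.1 hv').2 a ha

open Classical in
lemma totalVariation_stepFunction (hP : ∀ i j, i ≠ j → Disjoint (P i) (P j)) (t : Fin k → ℝ) :
    G.totalVariation (stepFunction P t) =
      (∑ a, ∑ b, |t a - t b| * G.cutWeight (P a) (P b)) / 2 +
        ∑ a, |t a| * G.cutWeight (P a) (Finset.univ.filter fun v => ∀ j, v ∉ P j) := by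
  set Z := Finset.univ.filter fun v => ∀ j, v ∉ P j with hZ
  have hz : ∀ v ∈ Z, stepFunction P t v = 0 := fun v hv =>
    stepFunction_of_notMem t (Finset.mem_filter.1 hv).2
  have key : ∀ (A B : Finset V) (α β : ℝ), (∀ v ∈ A, stepFunction P t v = α) →
      (∀ v ∈ B, stepFunction P t v = β) →
      ∑ i ∈ A, ∑ j ∈ B, G.w i j * |stepFunction P t i - stepFunction P t j| =
        |α - β| * G.cutWeight A B := by
    intro A B α β hA hB
    rw [cutWeight, Finset.mul_sum]
    refine Finset.sum_congr rfl fun i hi => ?_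
    rw [Finset.mul_sum]
    refine Finset.sum_congr rfl fun j hj => ?_
    rw [hA i hi, hB j hj, mul_comm]
  have hmem : ∀ a, ∀ v ∈ P a, stepFunction P t v = t a := fun a v hv => stepFunction_of_mem hP t hv
  have h1 : ∀ A : Finset V, ∑ i ∈ A, ∑ j, G.w i j * |stepFunction P t i - stepFunction P t j| =
      ∑ b, ∑ i ∈ A, ∑ j ∈ P b, G.w i j * |stepFunction P t i - stepFunction P t j| +
        ∑ i ∈ A, ∑ j ∈ Z, G.w i j * |stepFunction P t i - stepFunction P t j| := by
    intro A
    rw [Finset.sum_comm (s := Finset.univ) (t := A), ← Finset.sum_add_distrib]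
    exact Finset.sum_congr rfl fun i _ => sum_eq_sum_blocks hP _
  rw [totalVariation, sum_eq_sum_blocks hP]
  simp only [h1, ← hZ]
  have h2 : ∀ a b, ∑ i ∈ P a, ∑ j ∈ P b, G.w i j * |stepFunction P t i - stepFunction P t j| =
      |t a - t b| * G.cutWeight (P a) (P b) := fun a b => key _ _ _ _ (hmem a) (hmem b)
  have h3 : ∀ a, ∑ i ∈ P a, ∑ j ∈ Z, G.w i j * |stepFunction P t i - stepFunction P t j| =
      |t a| * G.cutWeight (P a) Z := fun a => by rw [key _ _ _ _ (hmem a) hz, sub_zero]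
  have h4 : ∀ a, ∑ i ∈ Z, ∑ j ∈ P a, G.w i j * |stepFunction P t i - stepFunction P t j| =
      |t a| * G.cutWeight (P a) Z := fun a => by
    rw [key _ _ _ _ hz (hmem a), zero_sub, abs_neg, cutWeight_comm]
  have h5 : ∑ i ∈ Z, ∑ j ∈ Z, G.w i j * |stepFunction P t i - stepFunction P t j| = 0 := by
    rw [key _ _ _ _ hz hz]; simp
  simp only [h2, h3, h4, h5, Finset.sum_add_distrib]
  ring

open Classical in
-- This explains the form of `multiCut`: a sign vector jumps by 2 between `S` and its complement and
-- by 1 towards the vertices outside all blocks.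
lemma totalVariation_stepFunction_signVector (hP : ∀ i j, i ≠ j → Disjoint (P i) (P j))
    (S : Finset (Fin k)) :
    G.totalVariation (stepFunction P (signVector S)) =
      2 * (∑ i ∈ S, ∑ j ∈ Sᶜ, G.cutWeight (P i) (P j)) +
        ∑ i, G.cutWeight (P i) (Finset.univ.filter fun v => ∀ j, v ∉ P j) := by
  rw [G.totalVariation_stepFunction hP]
  congr 1
  · have h1 : ∀ a ∈ S, ∑ b, |signVector S a - signVector S b| * G.cutWeight (P a) (P b) =
        2 * ∑ b ∈ Sᶜ, G.cutWeight (P a) (P b) := by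
      intro a ha
      rw [← Finset.sum_add_sum_compl S, Finset.mul_sum, Finset.sum_eq_zero, zero_add]
      · refine Finset.sum_congr rfl fun b hb => ?_
        rw [Finset.mem_compl] at hb
        norm_num [signVector, ha, hb]
      · intro b hb
        simp [signVector, ha, hb]
    have h2 : ∀ a ∈ Sᶜ, ∑ b, |signVector S a - signVector S b| * G.cutWeight (P a) (P b) =
        2 * ∑ b ∈ S, G.cutWeight (P a) (P b) := by
      intro a ha
      rw [Finset.mem_compl] at ha
      rw [← Finset.sum_add_sum_compl S, Finset.mul_sum,
        Finset.sum_eq_zero (s := Sᶜ), add_zero]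
      · refine Finset.sum_congr rfl fun b hb => ?_
        norm_num [signVector, ha, hb]
      · intro b hb
        rw [Finset.mem_compl] at hb
        simp [signVector, ha, hb]
    rw [← Finset.sum_add_sum_compl S, Finset.sum_congr rfl h1, Finset.sum_congr rfl h2,
      ← Finset.mul_sum, ← Finset.mul_sum, Finset.sum_comm (s := Sᶜ)]
    have h3 : ∑ b ∈ S, ∑ a ∈ Sᶜ, G.cutWeight (P a) (P b) =
        ∑ b ∈ S, ∑ a ∈ Sᶜ, G.cutWeight (P b) (P a) :=
      Finset.sum_congr rfl fun b _ => Finset.sum_congr rfl fun a _ => G.cutWeight_comm _ _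
    rw [h3]
    ring
  · refine Finset.sum_congr rfl fun a _ => ?_
    have : |signVector S a| = 1 := by
      unfold signVector
      split_ifs <;> simp
    rw [this, one_mul]

lemma totalVariation_signVector_le_multiCut (hP : ∀ i j, i ≠ j → Disjoint (P i) (P j))
    (S : Finset (Fin k)) :
    G.totalVariation (stepFunction P (signVector S)) ≤ G.multiCut P := by
  classical
  rw [G.totalVariation_stepFunction_signVector hP, multiCut]
  gcongr
  exact le_ciSup (f := fun S : Finset (Fin k) => ∑ i ∈ S, ∑ j ∈ Sᶜ, G.cutWeight (P i) (P j))
    (Set.finite_range _).bddAbove S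

lemma multiCut_le (hP : ∀ i j, i ≠ j → Disjoint (P i) (P j)) {r : ℝ}
    (h : ∀ S : Finset (Fin k), G.totalVariation (stepFunction P (signVector S)) ≤ r) :
    G.multiCut P ≤ r := by
  classical
  obtain ⟨S, hS⟩ := exists_eq_ciSup_of_finite
    (f := fun S : Finset (Fin k) => ∑ i ∈ S, ∑ j ∈ Sᶜ, G.cutWeight (P i) (P j))
  rw [multiCut, ← hS]
  have := h S
  rw [G.totalVariation_stepFunction_signVector hP] at this
  exact this

/-- A convex function on the cube is bounded by its values at the vertices, and these are the sign
vectors. -/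
lemma totalVariation_stepFunction_le_multiCut (hP : ∀ i j, i ≠ j → Disjoint (P i) (P j))
    {t : Fin k → ℝ} (ht : ‖t‖ ≤ 1) : G.totalVariation (stepFunction P t) ≤ G.multiCut P := by
  have hconv : ConvexOn ℝ Set.univ fun t => G.totalVariation (stepFunction P t) := by
    refine ⟨convex_univ, fun x _ y _ a b ha hb hab => ?_⟩
    simp only [stepFunction_add, stepFunction_smul]
    exact G.convexOn_totalVariation.2 trivial trivial ha hb hab
  have hmem : t ∈ convexHull ℝ (Set.univ.pi fun _ : Fin k => ({-1, 1} : Set ℝ)) := by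
    rw [convexHull_pi]
    intro a _
    rw [convexHull_pair, segment_eq_Icc (by norm_num)]
    have := (norm_le_pi_norm t a).trans ht
    rwa [Real.norm_eq_abs, abs_le] at this
  obtain ⟨s, hs, hts⟩ := hconv.exists_ge_of_mem_convexHull (Set.subset_univ _) hmem
  refine hts.trans ?_
  have : s = signVector (Finset.univ.filter fun a => s a = 1) := by
    funext a
    rcases hs a trivial with h | h
    · norm_num [signVector, Set.mem_singleton_iff.1 h, show s a = -1 from h]
    · simp [signVector, show s a = 1 from h]
  rw [this]
  exact G.totalVariation_signVector_le_multiCut hP _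

end MultiCut

/-! ### Admissible sets for the min-max eigenvalues, and the bound by the min-max cut. -/

lemma minmaxCut_le {k : ℕ} {P : Fin k → Finset V} (hne : ∀ i, (P i).Nonempty)
    (hP : ∀ i j, i ≠ j → Disjoint (P i) (P j)) : G.minmaxCut k ≤ G.multiCut P :=
  ciInf_le (Set.finite_range _).bddBelow
    (⟨P, hne, hP⟩ : {P : Fin k → Finset V //
      (∀ i, (P i).Nonempty) ∧ ∀ i j, i ≠ j → Disjoint (P i) (P j)})

lemma exists_disjoint_family {k : ℕ} (hk : k ≤ Fintype.card V) :
    ∃ P : Fin k → Finset V,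
      (∀ i, (P i).Nonempty) ∧ ∀ i j, i ≠ j → Disjoint (P i) (P j) := by
  obtain ⟨e⟩ : Nonempty (Fin k ↪ V) :=
    Function.Embedding.nonempty_of_card_le (by simpa using hk)
  exact ⟨fun i => {e i}, fun i => Finset.singleton_nonempty _, fun i j hij => by
    simpa using hij⟩

lemma exists_minmax_value (hvol : 0 < G.vol) {k : ℕ} (hk : 1 ≤ k) {P : Fin k → Finset V}
    (hne : ∀ i, (P i).Nonempty) (hP : ∀ i j, i ≠ j → Disjoint (P i) (P j)) :
    ∃ r ∈ {r : ℝ | ∃ A : Set (V → ℝ), A ⊆ Metric.sphere 0 1 ∧ IsCompact A ∧ (∀ x ∈ A, -x ∈ A) ∧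
      (k : ℕ∞) ≤ krasnoselskiiGenus A ∧
      IsGreatest ((fun x => G.totalVariation x / (G.vol * ‖x‖)) '' A) r},
      G.vol * r ≤ G.multiCut P := by
  have hsub : stepFunction P '' Metric.sphere 0 1 ⊆ Metric.sphere 0 1 := by
    rintro _ ⟨t, ht, rfl⟩
    rw [mem_sphere_zero_iff_norm] at ht ⊢
    rwa [norm_stepFunction hP hne]
  have hcomp : IsCompact (stepFunction P '' Metric.sphere 0 1) :=
    (isCompact_sphere 0 1).image continuous_stepFunction
  have hnonempty : (stepFunction P '' Metric.sphere 0 1).Nonempty := by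
    have : Nonempty (Fin k) := ⟨⟨0, hk⟩⟩
    exact ⟨_, fun _ => 1, by rw [mem_sphere_zero_iff_norm, pi_norm_const]; simp, rfl⟩
  have hcont : ContinuousOn (fun x => G.totalVariation x / (G.vol * ‖x‖))
      (stepFunction P '' Metric.sphere 0 1) := by
    refine G.continuous_totalVariation.continuousOn.div (by fun_prop) fun x hx => ?_
    rw [mem_sphere_zero_iff_norm.1 (hsub hx), mul_one]
    exact hvol.ne'
  obtain ⟨x, hx, hmax⟩ := hcomp.exists_isMaxOn hnonempty hcont
  refine ⟨_, ⟨_, hsub, hcomp, ?_, le_krasnoselskiiGenus_image_stepFunction P,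
    Set.mem_image_of_mem _ hx, ?_⟩, ?_⟩
  · rintro _ ⟨t, ht, rfl⟩
    exact ⟨-t, by simpa using ht, stepFunction_neg t⟩
  · rintro _ ⟨y, hy, rfl⟩
    exact hmax hy
  · rw [mem_sphere_zero_iff_norm.1 (hsub hx), mul_one, mul_div_cancel₀ _ hvol.ne']
    obtain ⟨t, ht, rfl⟩ := hx
    exact G.totalVariation_stepFunction_le_multiCut hP (mem_sphere_zero_iff_norm.1 ht).le

theorem vol_mul_minmaxEigenvalue_le_minmaxCut (hvol : 0 < G.vol) {k : ℕ} (hk : 1 ≤ k)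
    (hkV : k ≤ Fintype.card V) : G.vol * G.minmaxEigenvalue k ≤ G.minmaxCut k := by
  obtain ⟨P₀, h₀⟩ := exists_disjoint_family hkV
  have : Nonempty {P : Fin k → Finset V //
      (∀ i, (P i).Nonempty) ∧ ∀ i j, i ≠ j → Disjoint (P i) (P j)} := ⟨⟨P₀, h₀⟩⟩
  refine le_ciInf fun P => ?_
  obtain ⟨r, hr, hle⟩ := G.exists_minmax_value hvol hk P.2.1 P.2.2
  refine le_trans (mul_le_mul_of_nonneg_left (csInf_le ⟨0, ?_⟩ hr) hvol.le) hle
  rintro s ⟨A, -, -, -, -, ⟨x, -, rfl⟩, -⟩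
  exact div_nonneg (G.totalVariation_nonneg x) (mul_nonneg hvol.le (norm_nonneg x))

lemma le_vol_mul_minmaxEigenvalue (hvol : 0 < G.vol) {k : ℕ} (hk : 1 ≤ k)
    (hkV : k ≤ Fintype.card V) {b : ℝ}
    (h : ∀ A : Set (V → ℝ), A ⊆ Metric.sphere 0 1 → (∀ x ∈ A, -x ∈ A) →
      (k : ℕ∞) ≤ krasnoselskiiGenus A → ∃ x ∈ A, b ≤ G.totalVariation x) :
    b ≤ G.vol * G.minmaxEigenvalue k := by
  obtain ⟨P₀, h₀⟩ := exists_disjoint_family hkV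
  -- Some admissible value has to exist, because `sInf` of the empty set of reals is 0.
  obtain ⟨r, hr, -⟩ := G.exists_minmax_value hvol hk h₀.1 h₀.2
  rw [← div_le_iff₀' hvol]
  refine le_csInf ⟨r, hr⟩ ?_
  rintro s ⟨A, hA, -, hsymm, hgenus, -, hs⟩
  obtain ⟨x, hx, hbx⟩ := h A hA hsymm hgenus
  refine le_trans ?_ (hs (Set.mem_image_of_mem _ hx))
  rw [mem_sphere_zero_iff_norm.1 (hA hx), mul_one]
  gcongr

end WeightedGraph

/-! ### Eigenvectors, nodal domains and null domains -/

open Classical in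
/-- The vector that is `1` on `D₊(x)`, `-1` on `D₋(x)` and `0` on `D₀(x)`. -/
def extremalSign {V : Type*} [Fintype V] (x : V → ℝ) : V → ℝ :=
  fun i => if x i = ‖x‖ then 1 else if -x i = ‖x‖ then -1 else 0

section ExtremalSign

variable {V : Type*} [Fintype V] {x : V → ℝ}

lemma extremalSign_of_mem_domPos {i : V} (h : i ∈ domPos x) : extremalSign x i = 1 :=
  if_pos h

lemma extremalSign_of_mem_domNeg (hx : x ≠ 0) {i : V} (h : i ∈ domNeg x) :
    extremalSign x i = -1 := by
  have h' : -x i = ‖x‖ := h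
  have := norm_pos_iff.2 hx
  rw [extremalSign, if_neg (by linarith), if_pos h']

lemma extremalSign_of_notMem {i : V} (h : i ∉ domPos x) (h' : i ∉ domNeg x) :
    extremalSign x i = 0 :=
  (if_neg h).trans (if_neg h')

lemma mem_domZero_iff {i : V} : i ∈ domZero x ↔ i ∉ domPos x ∧ i ∉ domNeg x := by
  have h : |x i| ≤ ‖x‖ := norm_le_pi_norm x i
  simp only [domZero, domPos, domNeg, Set.mem_ofPred_eq]
  rw [lt_iff_le_and_ne, and_iff_right h, ← not_or, ne_eq, abs_eq (norm_nonneg x), neg_eq_iff_eq_neg]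

/-- Testing the subgradient inequality at `x + sign s` gives `∑ |s i| ≤ 1`, and testing it at 0
gives `‖x‖ ≤ ∑ s i * x i`. So equality holds in Hölder's inequality term by term, which fixes the
support and the signs of `s`. -/
lemma sum_extremalSign_mul_of_mem_subdifferential (hx : x ≠ 0) {s : V → ℝ}
    (hs : s ∈ subdifferential (fun y : V → ℝ => ‖y‖) x) : ∑ i, extremalSign x i * s i = 1 := by
  have hpos := norm_pos_iff.2 hx
  have hle : ∑ i, |s i| ≤ 1 := by
    have h := hs (x + fun i => (SignType.sign (s i) : ℝ))
    have h1 : ‖(fun i => (SignType.sign (s i) : ℝ) : V → ℝ)‖ ≤ 1 := by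
      rw [pi_norm_le_iff_of_nonneg zero_le_one]
      intro i
      rcases SignType.sign (s i) with _ | _ | _ <;> simp
    have h2 := norm_add_le x fun i => (SignType.sign (s i) : ℝ)
    have h3 : ∑ i, s i * ((x + fun i => (SignType.sign (s i) : ℝ)) i - x i) = ∑ i, |s i| :=
      Finset.sum_congr rfl fun i _ => by
        simp only [Pi.add_apply, add_sub_cancel_left]
        exact self_mul_sign _
    rw [h3] at h
    linarith
  have hge : ‖x‖ ≤ ∑ i, s i * x i := by
    have h := hs 0
    simp only [norm_zero, Pi.zero_apply, zero_sub, mul_neg, Finset.sum_neg_distrib] at h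
    linarith
  have hterm : ∀ i ∈ Finset.univ, s i * x i ≤ |s i| * ‖x‖ := fun i _ => by
    refine (le_abs_self _).trans ?_
    rw [abs_mul]
    exact mul_le_mul_of_nonneg_left (norm_le_pi_norm x i) (abs_nonneg _)
  have hsum : ∑ i, |s i| * ‖x‖ ≤ ∑ i, s i * x i := by
    rw [← Finset.sum_mul]
    nlinarith
  have heq := (Finset.sum_eq_sum_iff_of_le hterm).1 (le_antisymm (Finset.sum_le_sum hterm) hsum)
  have habs : ∑ i, |s i| = 1 := by
    refine le_antisymm hle ?_
    have := hge.trans (Finset.sum_le_sum hterm)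
    rw [← Finset.sum_mul] at this
    exact le_of_mul_le_mul_right (by simpa using this) hpos
  rw [← habs]
  refine Finset.sum_congr rfl fun i _ => ?_
  have hi := heq i (Finset.mem_univ i)
  by_cases hp : i ∈ domPos x
  · rw [extremalSign_of_mem_domPos hp, one_mul]
    rw [show x i = ‖x‖ from hp] at hi
    exact mul_right_cancel₀ hpos.ne' hi
  · by_cases hn : i ∈ domNeg x
    · rw [extremalSign_of_mem_domNeg hx hn]
      have : x i = -‖x‖ := by rw [← show -x i = ‖x‖ from hn, neg_neg]
      rw [this] at hi
      exact mul_right_cancel₀ hpos.ne' (by linarith)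
    · rw [extremalSign_of_notMem hp hn, zero_mul]
      have hlt : |x i| < ‖x‖ := mem_domZero_iff.2 ⟨hp, hn⟩
      by_contra hne
      have h1 : 0 < |s i| := lt_of_le_of_ne (abs_nonneg _) hne
      have h2 : s i * x i ≤ |s i| * |x i| := by rw [← abs_mul]; exact le_abs_self _
      nlinarith

end ExtremalSign

namespace WeightedGraph

variable {V : Type*} [Fintype V] (G : WeightedGraph V)

/-- Antisymmetry of `z` turns the pairing into half the sum of `w i j * z i j * (y i - y j)` with `y
= extremalSign x`. As `y` is monotone in the entries of `x`, each `z i j` has the right sign; where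
`x i = x j`, the difference of `y` vanishes whatever `z i j` is. -/
lemma sum_mul_eq_totalVariation_extremalSign {x u : V → ℝ} (hx : x ≠ 0)
    (hu : u ∈ G.oneLaplacian x) :
    ∑ i, extremalSign x i * u i = G.totalVariation (extremalSign x) := by
  obtain ⟨z, hz, hu⟩ := hu
  have h1 : ∑ i, extremalSign x i * u i = ∑ i, ∑ j, G.w i j * (extremalSign x i * z i j) := by
    refine Finset.sum_congr rfl fun i _ => ?_
    rw [hu, Finset.mul_sum]
    exact Finset.sum_congr rfl fun j _ => by ring
  have h2 : ∑ i, extremalSign x i * u i = ∑ i, ∑ j, G.w i j * -(extremalSign x j * z i j) := by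
    rw [h1, Finset.sum_comm]
    refine Finset.sum_congr rfl fun j _ => Finset.sum_congr rfl fun i _ => ?_
    by_cases hij : G.toSimpleGraph.Adj i j
    · rw [(hz i j hij).2, G.w_symm]
      ring
    · rw [G.w_zero i j hij, G.w_zero j i fun h => hij h.symm, zero_mul, zero_mul]
  rw [totalVariation, eq_div_iff two_ne_zero, mul_two]
  nth_rewrite 1 [h1]
  rw [h2, ← Finset.sum_add_distrib]
  refine Finset.sum_congr rfl fun i _ => ?_
  rw [← Finset.sum_add_distrib]
  refine Finset.sum_congr rfl fun j _ => ?_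
  by_cases hij : G.toSimpleGraph.Adj i j
  swap
  · simp [G.w_zero i j hij]
  rw [← mul_add]
  congr 1
  have hsgn := (hz i j hij).1
  have hpos := norm_pos_iff.2 hx
  have hi := abs_le.1 (show |x i| ≤ ‖x‖ from norm_le_pi_norm x i)
  have hj := abs_le.1 (show |x j| ≤ ‖x‖ from norm_le_pi_norm x j)
  rcases lt_trichotomy (x i) (x j) with h | h | h
  · have : z i j = -1 := by
      rw [setSgn, if_neg (by linarith), if_pos (by linarith)] at hsgn
      exact hsgn
    have hle : extremalSign x i ≤ extremalSign x j := by
      unfold extremalSign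
      split_ifs <;> linarith
    rw [this, abs_of_nonpos (by linarith)]
    ring
  · have : extremalSign x i = extremalSign x j := by
      unfold extremalSign
      rw [h]
    rw [this]
    simp
  · have : z i j = 1 := by
      rw [setSgn, if_pos (by linarith)] at hsgn
      exact hsgn
    have hle : extremalSign x j ≤ extremalSign x i := by
      unfold extremalSign
      split_ifs <;> linarith
    rw [this, abs_of_nonneg (by linarith)]
    ring

lemma IsEigenpair.vol_mul_eq {c : ℝ} {x : V → ℝ} (h : G.IsEigenpair c x) :
    G.vol * c = G.totalVariation (extremalSign x) := by
  obtain ⟨hx, u, hu, s, hs, h0⟩ := h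
  rw [← G.sum_mul_eq_totalVariation_extremalSign hx hu]
  have : u = (c * G.vol) • s := (sub_eq_zero.1 h0.symm)
  rw [this]
  have : ∑ i, extremalSign x i * ((c * G.vol) • s) i =
      (c * G.vol) * ∑ i, extremalSign x i * s i := by
    rw [Finset.mul_sum]
    exact Finset.sum_congr rfl fun i _ => by
      simp only [Pi.smul_apply, smul_eq_mul]
      ring
  rw [this, sum_extremalSign_mul_of_mem_subdifferential hx hs]
  ring

/-- A disjoint family of nonempty sets bounds the min-max cut by the total variation of any
function whose jumps are large enough along the boundaries of the family. -/
lemma minmaxCut_card_le_totalVariation {ι : Type*} [Finite ι] (Q : ι → Set V)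
    (hne : ∀ a, (Q a).Nonempty) (hQ : ∀ a b v, v ∈ Q a → v ∈ Q b → a = b) (y : V → ℝ)
    (h1 : ∀ i j a b, G.toSimpleGraph.Adj i j → i ∈ Q a → j ∈ Q b → a ≠ b → 2 ≤ |y i - y j|)
    (h2 : ∀ i j a, G.toSimpleGraph.Adj i j → i ∈ Q a → (∀ b, j ∉ Q b) → 1 ≤ |y i - y j|) :
    G.minmaxCut (Nat.card ι) ≤ G.totalVariation y := by
  classical
  set e := (Finite.equivFin ι).symm
  set P : Fin (Nat.card ι) → Finset V := fun a => (Q (e a)).toFinset with hPdef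
  have hmem : ∀ a v, v ∈ P a ↔ v ∈ Q (e a) := fun a v => Set.mem_toFinset
  have hP : ∀ i j, i ≠ j → Disjoint (P i) (P j) := by
    intro a b hab
    rw [Finset.disjoint_left]
    intro v hv hv'
    exact hab (e.injective (hQ _ _ v ((hmem _ _).1 hv) ((hmem _ _).1 hv')))
  refine (G.minmaxCut_le (P := P) (fun a => ?_) hP).trans (G.multiCut_le hP fun S => ?_)
  · obtain ⟨v, hv⟩ := hne (e a)
    exact ⟨v, (hmem _ _).2 hv⟩
  -- The comparison is made edge by edge: a sign step function jumps by at most 2 between two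
  -- blocks, by 1 between a block and the outside, and nowhere else.
  refine G.totalVariation_le_of_adj fun i j hij => ?_
  have hout : ∀ v, (∀ a, v ∉ P a) → ∀ b, v ∉ Q b := fun v hv b hb =>
    hv (e.symm b) ((hmem _ _).2 (by simpa using hb))
  have hsign : ∀ a, |signVector S a| = 1 := fun a => by
    unfold signVector
    split_ifs <;> simp
  by_cases hi : ∃ a, i ∈ P a
  · obtain ⟨a, ha⟩ := hi
    by_cases hj : ∃ b, j ∈ P b
    · obtain ⟨b, hb⟩ := hj
      rw [stepFunction_of_mem hP _ ha, stepFunction_of_mem hP _ hb]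
      by_cases hab : a = b
      · simp [hab]
      · refine le_trans ?_ (h1 i j _ _ hij ((hmem _ _).1 ha) ((hmem _ _).1 hb)
          (e.injective.ne hab))
        refine (abs_sub _ _).trans ?_
        rw [hsign, hsign]
        norm_num
    · push Not at hj
      rw [stepFunction_of_mem hP _ ha, stepFunction_of_notMem _ hj, sub_zero, hsign]
      exact h2 i j _ hij ((hmem _ _).1 ha) (hout j hj)
  · push Not at hi
    by_cases hj : ∃ b, j ∈ P b
    · obtain ⟨b, hb⟩ := hj
      rw [stepFunction_of_mem hP _ hb, stepFunction_of_notMem _ hi, zero_sub, abs_neg, hsign,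
        abs_sub_comm]
      exact h2 j i _ hij.symm ((hmem _ _).1 hb) (hout i hi)
    · push Not at hj
      rw [stepFunction_of_notMem _ hi, stepFunction_of_notMem _ hj, sub_zero, abs_zero]
      exact abs_nonneg _

end WeightedGraph

/-! ### Components of induced subgraphs as families of vertex sets. -/

/-- The vertex set of a connected component of an induced subgraph. -/
def inducedComponent {V : Type*} (G : SimpleGraph V) (s : Set V)
    (C : (G.induce s).ConnectedComponent) : Set V :=
  {v | ∃ h : v ∈ s, (G.induce s).connectedComponentMk ⟨v, h⟩ = C}

section InducedComponent

variable {V : Type*} {G : SimpleGraph V} {s : Set V}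

lemma inducedComponent_nonempty (C : (G.induce s).ConnectedComponent) :
    (inducedComponent G s C).Nonempty := by
  obtain ⟨⟨v, hv⟩, rfl⟩ := C.exists_rep
  exact ⟨v, hv, rfl⟩

lemma inducedComponent_subset (C : (G.induce s).ConnectedComponent) :
    inducedComponent G s C ⊆ s := fun _ hv => hv.1

lemma eq_of_mem_inducedComponent {C C' : (G.induce s).ConnectedComponent} {v : V}
    (h : v ∈ inducedComponent G s C) (h' : v ∈ inducedComponent G s C') : C = C' := by
  obtain ⟨hv, rfl⟩ := h
  exact h'.2

lemma eq_of_adj_of_mem_inducedComponent {C C' : (G.induce s).ConnectedComponent} {v w : V}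
    (hvw : G.Adj v w) (h : v ∈ inducedComponent G s C) (h' : w ∈ inducedComponent G s C') :
    C = C' := by
  obtain ⟨hv, rfl⟩ := h
  obtain ⟨hw, rfl⟩ := h'
  refine SimpleGraph.ConnectedComponent.sound (SimpleGraph.Adj.reachable ?_)
  simpa using hvw

lemma notMem_of_forall_notMem_inducedComponent {v : V}
    (h : ∀ C : (G.induce s).ConnectedComponent, v ∉ inducedComponent G s C) : v ∉ s :=
  fun hv => h _ ⟨hv, rfl⟩

end InducedComponent

namespace WeightedGraph

variable {V : Type*} [Fintype V] (G : WeightedGraph V)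

lemma minmaxCut_numNodalDomains_le {x : V → ℝ} (hx : x ≠ 0) :
    G.minmaxCut (G.numNodalDomains x) ≤ G.totalVariation (extremalSign x) := by
  rw [numNodalDomains, ← Nat.card_sum]
  refine G.minmaxCut_card_le_totalVariation
    (Sum.elim (inducedComponent _ _) (inducedComponent _ _)) ?_ ?_ _ ?_ ?_
  · rintro (C | C) <;> exact inducedComponent_nonempty C
  · have hdisj : ∀ v, v ∈ domPos x → v ∉ domNeg x := fun v hv hv' => by
      have h1 := extremalSign_of_mem_domPos hv
      rw [extremalSign_of_mem_domNeg hx hv'] at h1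
      norm_num at h1
    rintro (C | C) (C' | C') v hv hv'
    · exact congrArg Sum.inl (eq_of_mem_inducedComponent hv hv')
    · exact absurd (inducedComponent_subset C' hv') (hdisj v (inducedComponent_subset C hv))
    · exact absurd (inducedComponent_subset C hv) (hdisj v (inducedComponent_subset C' hv'))
    · exact congrArg Sum.inr (eq_of_mem_inducedComponent hv hv')
  · rintro i j (C | C) (C' | C') hij hi hj hne
    · exact absurd (congrArg Sum.inl (eq_of_adj_of_mem_inducedComponent hij hi hj)) hne
    · rw [extremalSign_of_mem_domPos (inducedComponent_subset C hi),
        extremalSign_of_mem_domNeg hx (inducedComponent_subset C' hj)]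
      norm_num
    · rw [extremalSign_of_mem_domPos (inducedComponent_subset C' hj),
        extremalSign_of_mem_domNeg hx (inducedComponent_subset C hi)]
      norm_num
    · exact absurd (congrArg Sum.inr (eq_of_adj_of_mem_inducedComponent hij hi hj)) hne
  · intro i j a hij hi hj
    have hj0 : extremalSign x j = 0 := extremalSign_of_notMem
      (notMem_of_forall_notMem_inducedComponent fun C => hj (Sum.inl C))
      (notMem_of_forall_notMem_inducedComponent fun C => hj (Sum.inr C))
    rcases a with C | C
    · rw [hj0, extremalSign_of_mem_domPos (inducedComponent_subset C hi)]
      norm_num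
    · rw [hj0, extremalSign_of_mem_domNeg hx (inducedComponent_subset C hi)]
      norm_num

/-- Edges between different null domains do not exist, and an edge leaving `D₀(x)` ends where
`extremalSign x` is ±1, so it has a jump of 1. -/
lemma minmaxCut_numNullDomains_le {x : V → ℝ} (hx : x ≠ 0) :
    G.minmaxCut (G.numNullDomains x) ≤ G.totalVariation (extremalSign x) := by
  refine G.minmaxCut_card_le_totalVariation (inducedComponent _ _) inducedComponent_nonempty
    (fun _ _ _ => eq_of_mem_inducedComponent) _
    (fun i j C C' hij hi hj hne => absurd (eq_of_adj_of_mem_inducedComponent hij hi hj) hne) ?_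
  intro i j C hij hi hj
  have hi0 := mem_domZero_iff.1 (inducedComponent_subset C hi)
  have hj0 := notMem_of_forall_notMem_inducedComponent hj
  rw [mem_domZero_iff, not_and_or, not_not, not_not] at hj0
  rw [extremalSign_of_notMem hi0.1 hi0.2]
  rcases hj0 with h | h
  · rw [extremalSign_of_mem_domPos h]
    norm_num
  · rw [extremalSign_of_mem_domNeg hx h]
    norm_num

end WeightedGraph

/-! ### Maximum cuts, minimum cuts, and the extreme min-max eigenvalues -/

open Classical in
/-- The function that is `1` on `S` and `-1` on the complement of `S`. -/
def cutFunction {V : Type*} (S : Finset V) : V → ℝ := fun v => if v ∈ S then 1 else -1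

lemma abs_cutFunction {V : Type*} (S : Finset V) (v : V) : |cutFunction S v| = 1 := by
  unfold cutFunction
  split_ifs <;> simp

lemma norm_cutFunction {V : Type*} [Fintype V] [Nonempty V] (S : Finset V) :
    ‖cutFunction S‖ = 1 := by
  apply le_antisymm
  · rw [pi_norm_le_iff_of_nonneg (zero_le_one' ℝ)]
    exact fun v => (abs_cutFunction S v).le
  · obtain ⟨v⟩ := ‹Nonempty V›
    exact (abs_cutFunction S v).ge.trans (norm_le_pi_norm (cutFunction S) v)

/-- A symmetric subset of the unit sphere whose genus is at least the dimension is the sphere. -/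
lemma mem_of_card_le_krasnoselskiiGenus {V : Type*} [Fintype V] [Nonempty V] {A : Set (V → ℝ)}
    (hA : A ⊆ Metric.sphere 0 1) (hsymm : ∀ x ∈ A, -x ∈ A)
    (hgenus : (Fintype.card V : ℕ∞) ≤ krasnoselskiiGenus A) {x : V → ℝ} (hx : ‖x‖ = 1) :
    x ∈ A := by
  by_contra hxA
  have hx0 : x ≠ 0 := by
    rintro rfl
    simp at hx
  have hrank : Module.finrank ℝ ((V → ℝ) ⧸ (ℝ ∙ x)) =
      Module.finrank ℝ (Fin (Fintype.card V - 1) → ℝ) := by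
    have h1 := Submodule.finrank_quotient_add_finrank (ℝ ∙ x)
    rw [finrank_span_singleton hx0, Module.finrank_fintype_fun_eq_card] at h1
    rw [Module.finrank_fintype_fun_eq_card, Fintype.card_fin]
    omega
  -- Projection along the line through `x` is odd into a space of dimension `n - 1`, and on the unit
  -- sphere it vanishes only at `x` and `-x`. If `A` avoids both, its genus is less than `n`.
  let f : (V → ℝ) →ₗ[ℝ] (Fin (Fintype.card V - 1) → ℝ) :=
    (LinearEquiv.ofFinrankEq _ _ hrank).toLinearMap ∘ₗ (ℝ ∙ x).mkQ
  have hle := le_krasnoselskiiGenus_iff.1 hgenus _ f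
    f.continuous_of_finiteDimensional.continuousOn (fun y _ => map_neg f y) ?_
  · have := Fintype.card_pos (α := V)
    omega
  · intro y hy h0
    have hy' : y ∈ (ℝ ∙ x) := by
      rw [← Submodule.Quotient.mk_eq_zero]
      simpa [f] using h0
    obtain ⟨c, rfl⟩ := Submodule.mem_span_singleton.1 hy'
    have hc : |c| = 1 := by
      have := mem_sphere_zero_iff_norm.1 (hA hy)
      rwa [norm_smul, hx, mul_one] at this
    rcases eq_or_eq_neg_of_abs_eq hc with rfl | rfl
    · exact hxA (by simpa using hy)
    · exact hxA (by simpa using hsymm _ hy)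

/-- A set of genus at least two on the unit sphere contains a function attaining both `1` and
`-1`. -/
lemma exists_mem_attaining_one_neg_one {V : Type*} [Fintype V] [Nonempty V] {A : Set (V → ℝ)}
    (hA : A ⊆ Metric.sphere 0 1) (hgenus : ((2 : ℕ) : ℕ∞) ≤ krasnoselskiiGenus A) :
    ∃ x ∈ A, (∃ i, x i = 1) ∧ ∃ j, x j = -1 := by
  -- The difference of the two norms is an odd real function, so without a zero on `A` it would
  -- bound the genus by 1. On the unit sphere the norms equal 2 exactly when 1, respectively -1, is
  -- attained; since at least one of the two is attained, equality forces both.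
  have hzero : ∃ x ∈ A, ‖x + 1‖ = ‖x - 1‖ := by
    by_contra! hne
    have := le_krasnoselskiiGenus_iff.1 hgenus 1 (fun x _ => ‖x + 1‖ - ‖x - 1‖)
      (by fun_prop) ?_ ?_
    · omega
    · intro x _
      funext _
      have h1 : ‖-x + 1‖ = ‖x - 1‖ := by rw [← norm_neg]; congr 1; abel
      have h2 : ‖-x - 1‖ = ‖x + 1‖ := by rw [← norm_neg]; congr 1; abel
      simp only [Pi.neg_apply, h1, h2, neg_sub]
    · intro x hx h
      exact hne x hx (sub_eq_zero.1 (congrFun h 0))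
  obtain ⟨x, hx, hx0⟩ := hzero
  have hnorm := mem_sphere_zero_iff_norm.1 (hA hx)
  have hattain : ∀ y : V → ℝ, ∃ i, |y i| = ‖y‖ := by
    intro y
    obtain ⟨i, hi⟩ := Finite.exists_max fun i => |y i|
    refine ⟨i, le_antisymm (norm_le_pi_norm y i) ?_⟩
    rw [pi_norm_le_iff_of_nonneg (abs_nonneg _)]
    exact hi
  have hle : ∀ i, |x i| ≤ 1 := fun i => hnorm ▸ norm_le_pi_norm x i
  refine ⟨x, hx, ?_⟩
  obtain ⟨i, hi⟩ := hattain x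
  rw [hnorm] at hi
  rcases eq_or_eq_neg_of_abs_eq hi with hi | hi
  · obtain ⟨j, hj⟩ := hattain (x - 1)
    have h1 : |x i + 1| ≤ ‖x + 1‖ := norm_le_pi_norm (x + 1) i
    rw [hi, hx0, ← hj, Pi.sub_apply, Pi.one_apply] at h1
    have h2 := abs_le.1 (hle j)
    refine ⟨⟨i, hi⟩, j, ?_⟩
    rw [abs_of_nonpos (by linarith : x j - 1 ≤ 0), abs_of_nonneg (by norm_num)] at h1
    linarith
  · obtain ⟨j, hj⟩ := hattain (x + 1)
    have h1 : |x i - 1| ≤ ‖x - 1‖ := norm_le_pi_norm (x - 1) i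
    rw [hi, ← hx0, ← hj, Pi.add_apply, Pi.one_apply] at h1
    have h2 := abs_le.1 (hle j)
    refine ⟨⟨j, ?_⟩, i, hi⟩
    rw [abs_of_nonneg (by linarith : 0 ≤ x j + 1), abs_of_nonpos (by norm_num)] at h1
    linarith

/-! ### The coarea formula for a single edge. -/

section Coarea

open MeasureTheory

/-- The integrand equals 2 precisely when the level `t` separates `a` from `b`. -/
lemma integrableOn_and_integral_abs_sign_sub {a b : ℝ} (ha : a ∈ Set.Icc (-1 : ℝ) 1)
    (hb : b ∈ Set.Icc (-1 : ℝ) 1) :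
    IntegrableOn (fun t : ℝ => |(if t < a then (1 : ℝ) else -1) - if t < b then 1 else -1|)
      (Set.Ico (-1) 1) ∧
    ∫ t in Set.Ico (-1 : ℝ) 1, |(if t < a then (1 : ℝ) else -1) - if t < b then 1 else -1| =
      2 * |a - b| := by
  wlog hab : a ≤ b generalizing a b
  · have := this hb ha (le_of_not_ge hab)
    simpa only [abs_sub_comm] using this
  have heq : (fun t : ℝ => |(if t < a then (1 : ℝ) else -1) - if t < b then 1 else -1|) =
      (Set.Ico a b).indicator fun _ => 2 := by
    funext t
    rw [Set.indicator_apply]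
    by_cases h1 : t < a
    · have h2 : t < b := h1.trans_le hab
      have h3 : ¬ t ∈ Set.Ico a b := fun h => not_le.2 h1 h.1
      simp [h1, h2, h3]
    · by_cases h2 : t < b
      · have h3 : t ∈ Set.Ico a b := ⟨not_lt.1 h1, h2⟩
        norm_num [h1, h2, h3]
      · have h3 : ¬ t ∈ Set.Ico a b := fun h => h2 h.2
        simp [h1, h2, h3]
  rw [heq]
  constructor
  · exact (integrableOn_const (by simp)).indicator measurableSet_Ico
  · rw [setIntegral_indicator measurableSet_Ico, Set.Ico_inter_Ico, sup_of_le_right ha.1,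
      inf_of_le_right hb.2, setIntegral_const, Measure.real, Real.volume_Ico,
      ENNReal.toReal_ofReal (by linarith), abs_of_nonpos (by linarith), smul_eq_mul]
    ring

end Coarea

namespace WeightedGraph

variable {V : Type*} [Fintype V] (G : WeightedGraph V)

open Classical in
lemma totalVariation_cutFunction (S : Finset V) :
    G.totalVariation (cutFunction S) = 2 * G.cutWeight S Sᶜ := by
  have h1 : ∀ i ∈ S, ∑ j, G.w i j * |cutFunction S i - cutFunction S j| =
      2 * ∑ j ∈ Sᶜ, G.w i j := by
    intro i hi
    rw [← Finset.sum_add_sum_compl S, Finset.mul_sum, Finset.sum_eq_zero, zero_add]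
    · refine Finset.sum_congr rfl fun j hj => ?_
      rw [Finset.mem_compl] at hj
      norm_num [cutFunction, hi, hj, mul_comm]
    · intro j hj
      simp [cutFunction, hi, hj]
  have h2 : ∀ i ∈ Sᶜ, ∑ j, G.w i j * |cutFunction S i - cutFunction S j| =
      2 * ∑ j ∈ S, G.w i j := by
    intro i hi
    rw [Finset.mem_compl] at hi
    rw [← Finset.sum_add_sum_compl S, Finset.mul_sum, Finset.sum_eq_zero (s := Sᶜ), add_zero]
    · refine Finset.sum_congr rfl fun j hj => ?_
      norm_num [cutFunction, hi, hj, mul_comm]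
    · intro j hj
      rw [Finset.mem_compl] at hj
      simp [cutFunction, hi, hj]
  rw [totalVariation, ← Finset.sum_add_sum_compl S, Finset.sum_congr rfl h1,
    Finset.sum_congr rfl h2, ← Finset.mul_sum, ← Finset.mul_sum]
  have h3 := G.cutWeight_comm Sᶜ S
  unfold cutWeight at h3 ⊢
  rw [h3]
  ring

open Classical in
lemma le_maxcut {S : Finset V} (h0 : S ≠ ∅) (h1 : S ≠ Finset.univ) :
    2 * G.cutWeight S Sᶜ ≤ G.maxcut :=
  le_ciSup (f := fun S : {S : Finset V // S ≠ ∅ ∧ S ≠ Finset.univ} => 2 * G.cutWeight S.1 S.1ᶜ)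
    (Set.finite_range _).bddAbove ⟨S, h0, h1⟩

open Classical in
lemma mincut_le {S : Finset V} (h0 : S ≠ ∅) (h1 : S ≠ Finset.univ) :
    G.mincut ≤ 2 * G.cutWeight S Sᶜ :=
  ciInf_le (f := fun S : {S : Finset V // S ≠ ∅ ∧ S ≠ Finset.univ} => 2 * G.cutWeight S.1 S.1ᶜ)
    (Set.finite_range _).bddBelow ⟨S, h0, h1⟩

lemma nonempty_proper_subset (h : 2 ≤ Fintype.card V) :
    Nonempty {S : Finset V // S ≠ ∅ ∧ S ≠ Finset.univ} := by
  classical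
  obtain ⟨v, w, hvw⟩ := Fintype.one_lt_card_iff.1 h
  refine ⟨{v}, Finset.singleton_ne_empty v, fun heq => hvw ?_⟩
  have := Finset.mem_univ w
  rw [← heq, Finset.mem_singleton] at this
  exact this.symm

lemma totalVariation_cutFunction_le_maxcut (h : 2 ≤ Fintype.card V) (S : Finset V) :
    G.totalVariation (cutFunction S) ≤ G.maxcut := by
  classical
  rw [totalVariation_cutFunction]
  have hnonneg : ∀ A B : Finset V, 0 ≤ G.cutWeight A B := fun A B =>
    Finset.sum_nonneg fun i _ => Finset.sum_nonneg fun j _ => G.w_nonneg i j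
  have hpos : 0 ≤ G.maxcut := by
    obtain ⟨T, h0, h1⟩ := nonempty_proper_subset h
    exact (mul_nonneg zero_le_two (hnonneg _ _)).trans (G.le_maxcut h0 h1)
  by_cases h0 : S = ∅
  · simpa [h0, cutWeight] using hpos
  · by_cases h1 : S = Finset.univ
    · simpa [h1, cutWeight] using hpos
    · exact G.le_maxcut h0 h1

lemma totalVariation_le_vol_mul_minmaxEigenvalue_card (hvol : 0 < G.vol) [Nonempty V]
    {x : V → ℝ} (hx : ‖x‖ = 1) :
    G.totalVariation x ≤ G.vol * G.minmaxEigenvalue (Fintype.card V) :=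
  G.le_vol_mul_minmaxEigenvalue hvol Fintype.card_pos le_rfl fun _ hA hsymm hgenus =>
    ⟨x, mem_of_card_le_krasnoselskiiGenus hA hsymm hgenus hx, le_rfl⟩

/-- The family of all singletons is used: its sign step functions are the cut functions. -/
lemma minmaxCut_card_le [Nonempty V] {r : ℝ}
    (h : ∀ S : Finset V, G.totalVariation (cutFunction S) ≤ r) :
    G.minmaxCut (Fintype.card V) ≤ r := by
  classical
  set e := (Fintype.equivFin V).symm
  have hP : ∀ i j, i ≠ j → Disjoint ({e i} : Finset V) {e j} := fun i j hij => by
    simpa using hij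
  refine (G.minmaxCut_le (P := fun i => {e i}) (fun i => Finset.singleton_nonempty _) hP).trans
    (G.multiCut_le hP fun S => ?_)
  have : stepFunction (fun i => {e i}) (signVector S) = cutFunction (S.map e.toEmbedding) := by
    funext v
    rw [stepFunction_of_mem hP (a := e.symm v) _ (by simp)]
    simp [signVector, cutFunction, Finset.mem_map_equiv]
  rw [this]
  exact h _

lemma vol_mul_minmaxEigenvalue_card (hvol : 0 < G.vol) [Nonempty V] :
    G.vol * G.minmaxEigenvalue (Fintype.card V) = G.minmaxCut (Fintype.card V) :=
  le_antisymm (G.vol_mul_minmaxEigenvalue_le_minmaxCut hvol Fintype.card_pos le_rfl)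
    (G.minmaxCut_card_le fun S =>
      G.totalVariation_le_vol_mul_minmaxEigenvalue_card hvol (norm_cutFunction S))

lemma minmaxCut_card_eq_maxcut (hvol : 0 < G.vol) (h : 2 ≤ Fintype.card V) :
    G.minmaxCut (Fintype.card V) = G.maxcut := by
  classical
  have : Nonempty V := Fintype.card_pos_iff.1 (by omega)
  refine le_antisymm (G.minmaxCut_card_le (G.totalVariation_cutFunction_le_maxcut h)) ?_
  have := nonempty_proper_subset h
  refine ciSup_le fun S => ?_
  rw [← G.vol_mul_minmaxEigenvalue_card hvol, ← G.totalVariation_cutFunction]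
  exact G.totalVariation_le_vol_mul_minmaxEigenvalue_card hvol (norm_cutFunction S.1)

lemma minmaxCut_two_le_mincut (h : 2 ≤ Fintype.card V) : G.minmaxCut 2 ≤ G.mincut := by
  classical
  have := nonempty_proper_subset h
  refine le_ciInf fun ⟨S, h0, h1⟩ => ?_
  rw [← G.totalVariation_cutFunction]
  -- The family consists of `S` (for `true`) and its complement (for `false`). No vertex lies
  -- outside it, and every edge between its two members has jump 2.
  have key := G.minmaxCut_card_le_totalVariation (ι := Bool) (fun b => {v | v ∈ S ↔ b = true})
    ?_ ?_ (cutFunction S) ?_ ?_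
  · simpa using key
  · rintro (_ | _)
    · obtain ⟨v, hv⟩ := not_forall.1 (mt Finset.eq_univ_iff_forall.2 h1)
      exact ⟨v, by simpa using hv⟩
    · obtain ⟨v, hv⟩ := Finset.nonempty_iff_ne_empty.2 h0
      exact ⟨v, by simpa using hv⟩
  · intro a b v ha hb
    exact Bool.eq_iff_iff.2 (ha.symm.trans hb)
  · intro i j a b _ ha hb hab
    have ha : i ∈ S ↔ a = true := ha
    have hb : j ∈ S ↔ b = true := hb
    by_cases hi : i ∈ S <;> by_cases hj : j ∈ S
    · exact absurd (Bool.eq_iff_iff.2 (by rw [← ha, ← hb]; simp [hi, hj])) hab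
    · norm_num [cutFunction, hi, hj]
    · norm_num [cutFunction, hi, hj]
    · exact absurd (Bool.eq_iff_iff.2 (by rw [← ha, ← hb]; simp [hi, hj])) hab
  · intro i j a _ _ hj
    exact absurd (by simp : j ∈ {v | v ∈ S ↔ decide (j ∈ S) = true}) (hj (decide (j ∈ S)))

open MeasureTheory in
/-- A consequence of the coarea formula. -/
lemma mincut_le_totalVariation {x : V → ℝ} (hx : ∀ i, x i ∈ Set.Icc (-1 : ℝ) 1)
    (h1 : ∃ i, x i = 1) (h2 : ∃ j, x j = -1) : G.mincut ≤ G.totalVariation x := by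
  classical
  -- Superlevel sets. For `t ∈ [-1, 1)` they contain a vertex of value 1 and omit a vertex of value
  -- -1, so each is a proper cut. Integration over this interval of length 2 gives `2 * mincut ≤ 2 *
  -- I(x)`.
  set S : ℝ → Finset V := fun t => Finset.univ.filter fun v => t < x v with hS
  have hval : ∀ t v, cutFunction (S t) v = if t < x v then 1 else -1 := fun t v => by
    simp [cutFunction, hS]
  have hint : ∀ i j, IntegrableOn
      (fun t => G.w i j * |cutFunction (S t) i - cutFunction (S t) j|) (Set.Ico (-1) 1) :=
    fun i j => by
      simp only [hval]
      exact (integrableOn_and_integral_abs_sign_sub (hx i) (hx j)).1.const_mul _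
  have hintsum : IntegrableOn (fun t => G.totalVariation (cutFunction (S t))) (Set.Ico (-1) 1) :=
    (integrable_finsetSum _ fun i _ => integrable_finsetSum _ fun j _ => hint i j).div_const 2
  have hcoarea : ∫ t in Set.Ico (-1 : ℝ) 1, G.totalVariation (cutFunction (S t)) =
      2 * G.totalVariation x := by
    unfold totalVariation
    rw [integral_div, integral_finsetSum _ fun i _ => integrable_finsetSum _ fun j _ => hint i j]
    rw [mul_div_assoc', Finset.mul_sum]
    congr 1
    refine Finset.sum_congr rfl fun i _ => ?_
    rw [integral_finsetSum _ fun j _ => hint i j, Finset.mul_sum]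
    refine Finset.sum_congr rfl fun j _ => ?_
    simp only [hval]
    rw [integral_const_mul, (integrableOn_and_integral_abs_sign_sub (hx i) (hx j)).2]
    ring
  have hmono : ∫ _t in Set.Ico (-1 : ℝ) 1, G.mincut ≤
      ∫ t in Set.Ico (-1 : ℝ) 1, G.totalVariation (cutFunction (S t)) := by
    refine setIntegral_mono_on (integrableOn_const (by simp)) hintsum measurableSet_Ico
      fun t ht => ?_
    rw [totalVariation_cutFunction]
    obtain ⟨i, hi⟩ := h1
    obtain ⟨j, hj⟩ := h2
    refine G.mincut_le (fun h => ?_) fun h => ?_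
    · have : i ∈ S t := by simpa [hS, hi] using ht.2
      simp [h] at this
    · have : j ∈ S t := by simp [h]
      have : t < -1 := by simpa [hS, hj] using this
      exact not_le.2 this ht.1
  rw [hcoarea, setIntegral_const, Measure.real, Real.volume_Ico,
    ENNReal.toReal_ofReal (by norm_num), smul_eq_mul] at hmono
  linarith

lemma mincut_le_vol_mul_minmaxEigenvalue_two (hvol : 0 < G.vol) (h : 2 ≤ Fintype.card V) :
    G.mincut ≤ G.vol * G.minmaxEigenvalue 2 := by
  have : Nonempty V := Fintype.card_pos_iff.1 (by omega)
  refine G.le_vol_mul_minmaxEigenvalue hvol one_le_two h fun A hA _ hgenus => ?_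
  obtain ⟨x, hx, h1, h2⟩ := exists_mem_attaining_one_neg_one hA hgenus
  refine ⟨x, hx, G.mincut_le_totalVariation (fun i => ?_) h1 h2⟩
  have := norm_le_pi_norm x i
  rw [mem_sphere_zero_iff_norm.1 (hA hx)] at this
  exact abs_le.1 this

end WeightedGraph

end

theorem mainTheorem5 {V : Type*} [Fintype V] (G : WeightedGraph V) (hvol : 0 < G.vol) :
    (∀ k : ℕ, 1 ≤ k → k ≤ Fintype.card V →
      G.vol * G.minmaxEigenvalue k ≤ G.minmaxCut k ∧
      ∀ m : ℕ, 1 ≤ m →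
        (∃ x : V → ℝ, G.IsEigenpair (G.minmaxEigenvalue k) x ∧
          (G.numNodalDomains x = m ∨ G.numNullDomains x = m)) →
        G.minmaxCut m ≤ G.vol * G.minmaxEigenvalue k) ∧
    G.vol * G.minmaxEigenvalue (Fintype.card V) = G.minmaxCut (Fintype.card V) ∧
    (2 ≤ Fintype.card V →
      G.minmaxCut (Fintype.card V) = G.maxcut ∧
      G.vol * G.minmaxEigenvalue 2 = G.minmaxCut 2 ∧
      G.minmaxCut 2 = G.mincut) := by
  have hV : Nonempty V := by
    by_contra hV
    rw [not_nonempty_iff] at hV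
    simp [WeightedGraph.vol] at hvol
  refine ⟨fun k hk hkV => ⟨G.vol_mul_minmaxEigenvalue_le_minmaxCut hvol hk hkV, ?_⟩,
    G.vol_mul_minmaxEigenvalue_card hvol, fun h => ?_⟩
  · rintro m - ⟨x, hx, rfl | rfl⟩
    · rw [hx.vol_mul_eq]
      exact G.minmaxCut_numNodalDomains_le hx.1
    · rw [hx.vol_mul_eq]
      exact G.minmaxCut_numNullDomains_le hx.1
  -- The inequalities `mincut ≤ vol(V) c_2 ≤ M_2 ≤ mincut` close up to a cycle, so all three are
  -- equal.
  · have h1 := G.mincut_le_vol_mul_minmaxEigenvalue_two hvol h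
    have h2 := G.vol_mul_minmaxEigenvalue_le_minmaxCut hvol one_le_two h
    have h3 := G.minmaxCut_two_le_mincut h
    exact ⟨G.minmaxCut_card_eq_maxcut hvol h, le_antisymm h2 (h3.trans h1),
      le_antisymm h3 (h1.trans h2)⟩
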